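/- Let $K=\mathrm{SU}(2)$, $U=K\times K$. For $\ell\in\frac12\mathbb{N}$ let $H^\ell$ be the space of complex homogeneous polynomials of degree $2\ell$ in $x,y$, with $K$ acting by $T^\ell(k)p=p\circ k^{t}$ ($k^t$ the transpose) and with the inner product for which $\psi^\ell_j=\binom{2\ell}{\ell-j}^{1/2}x^{\ell-j}y^{\ell+j}$, $j=-\ell,-\ell+1,\dots,\ell$, is an orthonormal basis. Let $T^{\ell_1,\ell_2}(k_1,k_2)=T^{\ell_1}(k_1)\otimes T^{\ell_2}(k_2)$ on the Hilbert space $H^{\ell_1,\ell_2}=H^{\ell_1}\otimes H^{\ell_2}$. Let $C^{\ell_1,\ell_2,\ell}_{j_1,j_2,j}$ be the Clebsch–Gordan coefficients of $\mathrm{SU}(2)$ in the standard (Condon–Shortley) normalization, which are $0$ unless $|\ell_1-\ell_2|\le\ell\le\ell_1+\ell_2$, $\ell_1+\ell_2-\ell\in\mathbb{Z}$ and $j_1+j_2=j$. Let $\beta^{\ell_1,\ell_2}_\ell:H^\ell\to H^{\ell_1,\ell_2}$ be the linear map with $\psi^\ell_j\mapsto\sum_{j_1,j_2}C^{\ell_1,\ell_2,\ell}_{j_1,j_2,j}\,\psi^{\ell_1}_{j_1}\otimes\psi^{\ell_2}_{j_2}$,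 and define $\Phi^\ell_{\ell_1,\ell_2}:U\to\mathrm{End}(H^\ell)$ by $\Phi^\ell_{\ell_1,\ell_2}(x)=(\beta^{\ell_1,\ell_2}_\ell)^*\circ T^{\ell_1,\ell_2}(x)\circ\beta^{\ell_1,\ell_2}_\ell$. Let $\varphi=\Phi^0_{1/2,1/2}$, regarded as a complex-valued function on $U$ through $\mathrm{End}(H^0)\cong\mathbb{C}$. Let $\ell,\ell_1,\ell_2\in\frac12\mathbb{N}$ satisfy $|\ell_1-\ell_2|\le\ell\le\ell_1+\ell_2$ and $\ell_1+\ell_2-\ell\in\mathbb{Z}$. Then, as functions on $U$, $$\varphi\cdot\Phi^{\ell}_{\ell_1,\ell_2}=\sum_{m_1=|\ell_1-\frac12|}^{\ell_1+\frac12}\ \sum_{m_2=|\ell_2-\frac12|}^{\ell_2+\frac12}\left|a^{(\ell_1,\ell_2)}_{(m_1,m_2),\ell}\right|^2\Phi^{\ell}_{m_1,m_2},$$ where $m_1,m_2$ run in steps of $1$ (the terms for which $(m_1,m_2)$ and $\ell$ violate $|m_1-m_2|\le\ell\le m_1+m_2$ are zero), and $$a^{(\ell_1,\ell_2)}_{(m_1,m_2),\ell}=\sum_{j_1,j_2,i_1,i_2,n_1,n_2}C^{\ell_1,\ell_2,\ell}_{j_1,j_2,\ell}\,C^{\frac12,\frac12,0}_{i_1,i_2,0}\,C^{\ell_1,\frac12,m_1}_{j_1,i_1,n_1}\,C^{\ell_2,\frac12,m_2}_{j_2,i_2,n_2}\,C^{m_1,m_2,\ell}_{n_1,n_2,\ell},$$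 the sum being over all weights $|j_1|\le\ell_1$, $|j_2|\le\ell_2$, $|i_1|\le\frac12$, $|i_2|\le\frac12$, $|n_1|\le m_1$, $|n_2|\le m_2$ (each running in steps of $1$). Moreover $a^{(\ell_1,\ell_2)}_{(\ell_1+1/2,\ell_2+1/2),\ell}\neq0$. The sum for $a^{(\ell_1,\ell_2)}_{(m_1,m_2),\ell}$ is really a double sum: a summand can be non-zero only if $j_1+j_2=\ell$, $i_1+i_2=0$, $n_1=j_1+i_1$ and $n_2=j_2+i_2$. -/

import Mathlib

open scoped TensorProduct Nat

noncomputable section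

namespace SUTwo

/-! Half-integers are encoded by their doubles: the natural number `L` stands for the spin `ℓ = L / 2`.
A weight `j ∈ {-ℓ, -ℓ + 1, …, ℓ}` is encoded by the number `i = ℓ + j ∈ {0, 1, …, L}`;
`weight L i = 2 i - L` is the double of `j`. -/

/-- The compact group `K = SU(2)`. -/
abbrev K : Type := Matrix.specialUnitaryGroup (Fin 2) ℂ

/-- The group `U = SU(2) × SU(2)`. -/
abbrev U : Type := K × K

/-- The double `2 j` of the weight `j = i - ℓ`, where `ℓ = L / 2`. -/
def weight (L i : ℕ) : ℤ := 2 * (i : ℤ) - (L : ℤ)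

/-! ### The irreducible representations of `SU(2)` -/

/-- `H^ℓ = ℂ[x, y]_{2ℓ}`, the space of homogeneous polynomials of degree `L = 2ℓ`
in `x = X 0` and `y = X 1`. -/
abbrev H (L : ℕ) : Type := ↥(MvPolynomial.homogeneousSubmodule (Fin 2) ℂ L)

/-- The exponent of the monomial `x ^ (ℓ - j) y ^ (ℓ + j)`, where `i = ℓ + j`. -/
def expo (L i : ℕ) : Fin 2 →₀ ℕ := Finsupp.single 0 (L - i) + Finsupp.single 1 i

theorem expo_degree {L i : ℕ} (hi : i ≤ L) : (expo L i).degree = L := by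
  simp only [expo, map_add, Finsupp.degree_single]
  omega

theorem expo_injective {L i i' : ℕ} (h : expo L i = expo L i') : i = i' := by
  simpa [expo] using DFunLike.congr_fun h 1

theorem eq_expo {L : ℕ} {d : Fin 2 →₀ ℕ} (hd : d.degree = L) : d = expo L (d 1) := by
  have h : d 0 + d 1 = L := by
    rw [← hd, Finsupp.degree_eq_sum, Fin.sum_univ_two]
  ext k
  fin_cases k <;> (simp [expo]; try omega)

/-- The weight vector `ψ^ℓ_j = (2ℓ choose ℓ - j)^{1/2} x ^ (ℓ - j) y ^ (ℓ + j)`, with `i = ℓ + j`. -/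
def psi (L : ℕ) (i : Fin (L + 1)) : H L :=
  ⟨MvPolynomial.monomial (expo L i) ((√((L.choose (L - (i : ℕ)) : ℕ) : ℝ) : ℝ) : ℂ),
    (MvPolynomial.mem_homogeneousSubmodule _ _).2
      (MvPolynomial.isHomogeneous_monomial _ (expo_degree (Nat.lt_succ_iff.1 i.2)))⟩

theorem sqrt_choose_ne_zero (L : ℕ) (i : Fin (L + 1)) :
    ((√((L.choose (L - (i : ℕ)) : ℕ) : ℝ) : ℝ) : ℂ) ≠ 0 := by
  have : 0 < L.choose (L - (i : ℕ)) := Nat.choose_pos (Nat.sub_le _ _)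
  have h2 : (0 : ℝ) < √((L.choose (L - (i : ℕ)) : ℕ) : ℝ) := Real.sqrt_pos.2 (by exact_mod_cast this)
  exact_mod_cast h2.ne'

theorem coeff_psi (L : ℕ) (i i' : Fin (L + 1)) :
    MvPolynomial.coeff (expo L i') (psi L i : MvPolynomial (Fin 2) ℂ) =
      if i = i' then ((√((L.choose (L - (i : ℕ)) : ℕ) : ℝ) : ℝ) : ℂ) else 0 := by
  classical
  rw [psi, MvPolynomial.coeff_monomial]
  by_cases h : i = i'
  · simp [h]
  · rw [if_neg h, if_neg (fun h' => h (Fin.ext (expo_injective h')))]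

/-- The coordinates of a homogeneous polynomial with respect to the vectors `ψ^ℓ_j`. -/
def coordinates (L : ℕ) : H L →ₗ[ℂ] (Fin (L + 1) → ℂ) where
  toFun p i := MvPolynomial.coeff (expo L i) (p : MvPolynomial (Fin 2) ℂ) /
    ((√((L.choose (L - (i : ℕ)) : ℕ) : ℝ) : ℝ) : ℂ)
  map_add' p q := by ext i; simp [add_div]
  map_smul' c p := by ext i; simp [mul_div_assoc]

theorem coordinates_psi (L : ℕ) (i i' : Fin (L + 1)) :
    coordinates L (psi L i) i' = if i = i' then 1 else 0 := by
  simp only [coordinates, LinearMap.coe_mk, AddHom.coe_mk, coeff_psi]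
  by_cases h : i = i'
  · subst h; simpa using div_self (sqrt_choose_ne_zero L i)
  · simp [h]

theorem coordinates_injective (L : ℕ) : Function.Injective (coordinates L) := by
  rw [← LinearMap.ker_eq_bot, LinearMap.ker_eq_bot']
  intro p hp
  apply Subtype.ext
  ext d
  by_contra hd
  have hdeg : d.degree = L := by
    have := (MvPolynomial.mem_homogeneousSubmodule _ _).1 p.2 hd
    simpa [Finsupp.weight_apply, Finsupp.degree_eq_sum, Finsupp.sum_fintype] using this
  have hle : d 1 < L + 1 := by
    rw [Finsupp.degree_eq_sum, Fin.sum_univ_two] at hdeg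
    omega
  have h0 := congrFun hp ⟨d 1, hle⟩
  simp only [coordinates, LinearMap.coe_mk, AddHom.coe_mk, Pi.zero_apply, div_eq_zero_iff,
    sqrt_choose_ne_zero L ⟨d 1, hle⟩, or_false] at h0
  rw [← eq_expo hdeg] at h0
  exact hd (by simpa using h0)

theorem coordinates_sum (L : ℕ) (v : Fin (L + 1) → ℂ) :
    coordinates L (∑ i, v i • psi L i) = v := by
  ext i'
  simp [map_sum, Finset.sum_apply, coordinates_psi]

/-- The basis of `H^ℓ` that consists of the vectors `ψ^ℓ_j`. -/
def weightBasis (L : ℕ) : Module.Basis (Fin (L + 1)) ℂ (H L) :=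
  Module.Basis.ofEquivFun (LinearEquiv.ofBijective (coordinates L)
    ⟨coordinates_injective L, fun v => ⟨_, coordinates_sum L v⟩⟩)

theorem weightBasis_apply (L : ℕ) (i : Fin (L + 1)) : weightBasis L i = psi L i := by
  apply (weightBasis L).repr.injective
  ext i'
  rw [Module.Basis.repr_self, Finsupp.single_apply]
  exact (coordinates_psi L i i').symm

/-- The Hermitian inner product on `H^ℓ` for which the `ψ^ℓ_j` are orthonormal. -/
@[reducible] def innerCore (L : ℕ) : InnerProductSpace.Core ℂ (H L) where
  inner p q := ∑ i, (starRingEnd ℂ) ((weightBasis L).repr p i) * (weightBasis L).repr q i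
  conj_inner_symm p q := by simp [map_sum, mul_comm]
  re_inner_nonneg p := by
    simp only [map_sum]
    refine Finset.sum_nonneg fun i _ => ?_
    rw [← Complex.normSq_eq_conj_mul_self]
    exact Complex.normSq_nonneg _
  add_left p q r := by simp [add_mul, Finset.sum_add_distrib]
  smul_left p q c := by simp [Finset.mul_sum, mul_assoc]
  definite p hp := by
    apply (weightBasis L).repr.injective
    ext i
    have h : ∑ i, Complex.normSq ((weightBasis L).repr p i) = 0 := by
      have h2 : ((∑ i, Complex.normSq ((weightBasis L).repr p i) : ℝ) : ℂ) = 0 := by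
        rw [← hp]; push_cast; simp only [Complex.normSq_eq_conj_mul_self]
      exact_mod_cast h2
    have := (Finset.sum_eq_zero_iff_of_nonneg (fun i _ => Complex.normSq_nonneg _)).1 h i
      (Finset.mem_univ i)
    simpa using Complex.normSq_eq_zero.1 this

instance instNormedAddCommGroupH (L : ℕ) : NormedAddCommGroup (H L) :=
  (innerCore L).toNormedAddCommGroup

instance instInnerProductSpaceH (L : ℕ) : InnerProductSpace ℂ (H L) :=
  InnerProductSpace.ofCore (innerCore L).toCore

instance instFiniteDimensionalH (L : ℕ) : FiniteDimensional ℂ (H L) :=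
  (weightBasis L).finiteDimensional_of_finite

theorem orthonormal_psi (L : ℕ) : Orthonormal ℂ (psi L) := by
  rw [orthonormal_iff_ite]
  intro i i'
  change ∑ k, (starRingEnd ℂ) ((weightBasis L).repr (psi L i) k) *
    (weightBasis L).repr (psi L i') k = _
  simp only [← weightBasis_apply, Module.Basis.repr_self, Finsupp.single_apply]
  simp

/-- The substitution `p ↦ p ∘ kᵗ` of polynomials: the variable `X r` is replaced by the `r`-th
coordinate of `kᵗ (x, y)`. -/
def substitution (k : Matrix (Fin 2) (Fin 2) ℂ) :
    MvPolynomial (Fin 2) ℂ →ₐ[ℂ] MvPolynomial (Fin 2) ℂ :=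
  MvPolynomial.aeval fun r => ∑ s, MvPolynomial.C (k.transpose r s) * MvPolynomial.X s

theorem substitution_homogeneous (k : Matrix (Fin 2) (Fin 2) ℂ) {L : ℕ}
    (p : MvPolynomial (Fin 2) ℂ) (hp : p ∈ MvPolynomial.homogeneousSubmodule (Fin 2) ℂ L) :
    (substitution k).toLinearMap p ∈ MvPolynomial.homogeneousSubmodule (Fin 2) ℂ L := by
  rw [MvPolynomial.mem_homogeneousSubmodule] at hp ⊢
  have := hp.aeval (fun r => ∑ s, MvPolynomial.C (k.transpose r s) * MvPolynomial.X s) (n := 1)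
    (fun r => MvPolynomial.IsHomogeneous.sum _ _ _ fun s _ =>
      MvPolynomial.isHomogeneous_C_mul_X _ _)
  simpa [substitution] using this

theorem substitution_one : substitution 1 = AlgHom.id ℂ _ := by
  ext r
  fin_cases r <;> simp [substitution]

theorem substitution_mul (k k' : Matrix (Fin 2) (Fin 2) ℂ) :
    substitution (k * k') = (substitution k).comp (substitution k') := by
  apply MvPolynomial.algHom_ext
  intro r
  simp only [substitution, AlgHom.comp_apply, MvPolynomial.aeval_X, Fin.sum_univ_two, map_add,
    map_mul, MvPolynomial.algHom_C, MvPolynomial.algebraMap_eq, Matrix.transpose_apply,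
    Matrix.mul_apply]
  ring

/-- The representation `T^ℓ` of `SU(2)` on `H^ℓ`, given by `T^ℓ(k) p = p ∘ kᵗ`. -/
def T (L : ℕ) : Representation ℂ K (H L) where
  toFun k := (substitution (k : Matrix (Fin 2) (Fin 2) ℂ)).toLinearMap.restrict
    (fun p hp => substitution_homogeneous _ p hp)
  map_one' := by
    ext1 p
    apply Subtype.ext
    simp [LinearMap.restrict_apply, substitution_one]
  map_mul' k k' := by
    ext1 p
    apply Subtype.ext
    simp [LinearMap.restrict_apply, substitution_mul]

/-- The outer tensor product representation `T^{ℓ₁,ℓ₂}` of `U` on `H^{ℓ₁,ℓ₂} = H^{ℓ₁} ⊗ H^{ℓ₂}`. -/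
def TT (L₁ L₂ : ℕ) (x : U) : H L₁ ⊗[ℂ] H L₂ →ₗ[ℂ] H L₁ ⊗[ℂ] H L₂ :=
  TensorProduct.map (T L₁ x.1) (T L₂ x.2)

/-! ### Clebsch–Gordan coefficients -/

/-- `|ℓ₁ - ℓ₂| ≤ ℓ ≤ ℓ₁ + ℓ₂` and `ℓ₁ + ℓ₂ - ℓ ∈ ℤ`. -/
def ContainsType (L₁ L₂ L : ℕ) : Prop :=
  |(L₁ : ℤ) - L₂| ≤ L ∧ (L : ℤ) ≤ L₁ + L₂ ∧ Even ((L₁ : ℤ) + L₂ - L)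

instance instDecidableContainsType (L₁ L₂ L : ℕ) : Decidable (ContainsType L₁ L₂ L) := by
  unfold ContainsType; infer_instance

/-- `1 / n!` for `n ≥ 0`, and `0` for `n < 0`. -/
def invFactorial (n : ℤ) : ℝ := if 0 ≤ n then 1 / ((n.toNat ! : ℕ) : ℝ) else 0

/-- The Clebsch–Gordan coefficient `C^{ℓ₁,ℓ₂,ℓ}_{j₁,j₂,j}` of `SU(2)` with the standard
(Condon–Shortley) normalization, by Racah's formula. Here `L₁ = 2ℓ₁`, `L₂ = 2ℓ₂`, `L = 2ℓ`,
`i₁ = ℓ₁ + j₁`, `i₂ = ℓ₂ + j₂`, `i = ℓ + j`, `a = ℓ₁ + ℓ₂ - ℓ`, `b = ℓ + ℓ₁ - ℓ₂`, `c = ℓ + ℓ₂ - ℓ₁`,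
so that, for instance, `ℓ₁ - j₁ - k = L₁ - i₁ - k` and `ℓ - ℓ₂ + j₁ + k = i₁ - a + k`. It vanishes
unless `(ℓ₁, ℓ₂)` contains `ℓ`, the weights are in range and `j₁ + j₂ = j`. -/
def clebschGordan (L₁ L₂ L i₁ i₂ i : ℕ) : ℝ :=
  if ContainsType L₁ L₂ L ∧ i₁ ≤ L₁ ∧ i₂ ≤ L₂ ∧ i ≤ L ∧
      weight L₁ i₁ + weight L₂ i₂ = weight L i then
    let a : ℕ := (L₁ + L₂ - L) / 2
    let b : ℕ := (L + L₁ - L₂) / 2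
    let c : ℕ := (L + L₂ - L₁) / 2
    √(((L + 1 : ℕ) : ℝ) * ((a ! : ℕ) : ℝ) * ((b ! : ℕ) : ℝ) * ((c ! : ℕ) : ℝ) /
        ((((L₁ + L₂ + L) / 2 + 1)! : ℕ) : ℝ)) *
      √(((i ! : ℕ) : ℝ) * (((L - i)! : ℕ) : ℝ) * ((i₁ ! : ℕ) : ℝ) * (((L₁ - i₁)! : ℕ) : ℝ) *
        ((i₂ ! : ℕ) : ℝ) * (((L₂ - i₂)! : ℕ) : ℝ)) *
      ∑ k ∈ Finset.range (a + 1), (-1 : ℝ) ^ k *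
        (invFactorial k * invFactorial ((a : ℤ) - k) *
          invFactorial ((L₁ : ℤ) - i₁ - k) * invFactorial ((i₂ : ℤ) - k) *
          invFactorial ((i₁ : ℤ) - a + k) * invFactorial ((c : ℤ) - i₂ + k))
  else 0

/-- `φ^{ℓ₁,ℓ₂}_{ℓ,j} = ∑ C^{ℓ₁,ℓ₂,ℓ}_{j₁,j₂,j} ψ^{ℓ₁}_{j₁} ⊗ ψ^{ℓ₂}_{j₂}`. -/
def coupledVector (L₁ L₂ L : ℕ) (i : Fin (L + 1)) : H L₁ ⊗[ℂ] H L₂ :=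
  ∑ i₁ : Fin (L₁ + 1), ∑ i₂ : Fin (L₂ + 1),
    (clebschGordan L₁ L₂ L i₁ i₂ i : ℂ) • (psi L₁ i₁ ⊗ₜ[ℂ] psi L₂ i₂)

/-- `β^{ℓ₁,ℓ₂}_ℓ : H^ℓ → H^{ℓ₁,ℓ₂}`, the linear map with `ψ^ℓ_j ↦ φ^{ℓ₁,ℓ₂}_{ℓ,j}`. -/
def beta (L₁ L₂ L : ℕ) : H L →ₗ[ℂ] H L₁ ⊗[ℂ] H L₂ :=
  (weightBasis L).constr ℂ (coupledVector L₁ L₂ L)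

/-! ### Spherical functions -/

/-- The spherical function `Φ^ℓ_{ℓ₁,ℓ₂} : U → End(H^ℓ)`, `x ↦ β^* ∘ T^{ℓ₁,ℓ₂}(x) ∘ β`. -/
def sphericalFunction (L₁ L₂ L : ℕ) (x : U) : H L →ₗ[ℂ] H L :=
  LinearMap.adjoint (beta L₁ L₂ L) ∘ₗ TT L₁ L₂ x ∘ₗ beta L₁ L₂ L

/-- The zonal spherical function `φ_ℓ = Φ^0_{ℓ,ℓ}`, regarded as a complex valued function: the
trace is the canonical identification of `End(H^0)` with `ℂ`, because `H^0` is one-dimensional. -/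
def zonalFunction (L : ℕ) (x : U) : ℂ :=
  LinearMap.trace ℂ (H 0) (sphericalFunction L L 0 x)

/-! ### The recurrence coefficients -/

/-- The (doubles of the) spins `m` with `|ℓ - 1/2| ≤ m ≤ ℓ + 1/2` and `ℓ + 1/2 - m ∈ ℤ`. -/
def neighbours (L : ℕ) : Finset ℕ := (Finset.range (L + 2)).filter fun M => ContainsType L 1 M

/-- The product `C^{ℓ₁,ℓ₂,ℓ}_{j₁,j₂,ℓ} C^{1/2,1/2,0}_{i₁,i₂,0} C^{ℓ₁,1/2,m₁}_{j₁,i₁,n₁}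
C^{ℓ₂,1/2,m₂}_{j₂,i₂,n₂} C^{m₁,m₂,ℓ}_{n₁,n₂,ℓ}`; the weights `j₁, j₂, i₁, i₂, n₁, n₂` are
encoded by `s₁ = ℓ₁ + j₁`, `s₂ = ℓ₂ + j₂`, `t₁ = 1/2 + i₁`, `t₂ = 1/2 + i₂`, `u₁ = m₁ + n₁`,
`u₂ = m₂ + n₂`, and the weight `ℓ` of spin `ℓ` by `ℓ + ℓ = L`. -/
def recursionTerm (L₁ L₂ M₁ M₂ L s₁ s₂ t₁ t₂ u₁ u₂ : ℕ) : ℝ :=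
  clebschGordan L₁ L₂ L s₁ s₂ L * clebschGordan 1 1 0 t₁ t₂ 0 *
    clebschGordan L₁ 1 M₁ s₁ t₁ u₁ * clebschGordan L₂ 1 M₂ s₂ t₂ u₂ *
    clebschGordan M₁ M₂ L u₁ u₂ L

/-- The coefficient `a^{(ℓ₁,ℓ₂)}_{(m₁,m₂),ℓ}`. -/
def recursionCoeff (L₁ L₂ M₁ M₂ L : ℕ) : ℝ :=
  ∑ s₁ : Fin (L₁ + 1), ∑ s₂ : Fin (L₂ + 1), ∑ t₁ : Fin 2, ∑ t₂ : Fin 2,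
    ∑ u₁ : Fin (M₁ + 1), ∑ u₂ : Fin (M₂ + 1), recursionTerm L₁ L₂ M₁ M₂ L s₁ s₂ t₁ t₂ u₁ u₂

end SUTwo

end

namespace SUTwo

noncomputable section

/-! In the weight bases, which are orthonormal, `β` has a real matrix `C` of Clebsch–Gordan
coefficients, so a spherical function is the compression `Cᵀ (T^{ℓ₁} ⊗ T^{ℓ₂}) C`. Multiplying by
`φ`, itself such a compression, gives `Pᵀ ((T^{ℓ₁} ⊗ T^{1/2}) ⊗ (T^{ℓ₂} ⊗ T^{1/2})) P`, where `P` is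
the product of `C` with the invariant vector of `H^{1/2} ⊗ H^{1/2}` (`zonalFunction_smul`). Each
`T^{ℓ} ⊗ T^{1/2}` splits as `∑ C_m T^m C_mᵀ` (`repMatrix_kronecker_eq_sum`).

What remains is the component `(C_{m₁}ᵀ ⊗ C_{m₂}ᵀ) P : H^ℓ → H^{m₁,m₂}`. It commutes with the
raising, lowering and weight operators, so by multiplicity one (`IsIntertwiner.eq_smul_cgMatrix`) it
is a scalar times the Clebsch–Gordan matrix. The highest-weight column of that matrix has norm one,
so pairing highest-weight columns identifies the scalar as `a` (`recursionMatrix_eq`). It enters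
once on each side of the compression, whence `|a|²`.

Two facts about the coefficients are needed. For arbitrary spins, infinitesimal equivariance
suffices, and it follows from a telescoping recurrence for Racah's sum (`racahSum_raise`) and its
reversal symmetry. Equivariance under the group is needed only when one factor has spin 1/2; there
`β` is given by partial derivatives or by multiplication with the variables (`TT_comp_beta_one`).

Non-vanishing of the top coefficient is read off from one matrix entry, to which a single product of
positive coefficients contributes. -/

theorem invFactorial_of_neg {n : ℤ} (hn : n < 0) : invFactorial n = 0 := by
  simp [invFactorial, not_le.2 hn]

theorem invFactorial_natCast (n : ℕ) : invFactorial (n : ℤ) = 1 / (n ! : ℝ) := by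
  simp [invFactorial]

/-- With `1 / n! = 0` for negative `n` the factorial recursion has no exceptions: at `n = 0` both
sides vanish. This is what spares the recurrences below any boundary cases. -/
theorem mul_invFactorial (n : ℤ) : (n : ℝ) * invFactorial n = invFactorial (n - 1) := by
  rcases lt_trichotomy n 0 with h | rfl | h
  · rw [invFactorial_of_neg h, invFactorial_of_neg (by omega), mul_zero]
  · rw [invFactorial_of_neg (n := 0 - 1) (by omega)]; simp
  · obtain ⟨m, rfl⟩ : ∃ m : ℕ, n = (m + 1 : ℕ) := ⟨n.toNat - 1, by omega⟩
    rw [show ((m + 1 : ℕ) : ℤ) - 1 = (m : ℕ) by push_cast; ring, invFactorial_natCast,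
      invFactorial_natCast, Nat.factorial_succ]
    have := Nat.factorial_ne_zero m
    push_cast
    field_simp

theorem invFactorial_sub_one {m n : ℤ} (h : m = n - 1) :
    invFactorial m = (n : ℝ) * invFactorial n := by rw [h, mul_invFactorial]

/-! ### The alternating sum in Racah's formula -/

/-- The summand of the alternating sum in Racah's formula. -/
def racahTerm (a : ℕ) (b c i₁ i₂ : ℤ) (k : ℕ) : ℝ :=
  (-1 : ℝ) ^ k * (invFactorial k * invFactorial ((a : ℤ) - k) *
    invFactorial (a + b - i₁ - k) * invFactorial (i₂ - k) *
    invFactorial (i₁ - a + k) * invFactorial (c - i₂ + k))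

/-- The alternating sum in Racah's formula. -/
def racahSum (a : ℕ) (b c i₁ i₂ : ℤ) : ℝ := ∑ k ∈ Finset.range (a + 1), racahTerm a b c i₁ i₂ k

/-- Creative telescoping: the same combination of summands is a difference `g k - g (k + 1)`, and
`g` vanishes at both ends because each end contains `1 / (-1)!`. This is the raising recurrence with
the square roots stripped off. -/
theorem racahSum_raise (a : ℕ) (b c i₁ i₂ : ℤ) :
    ((a + b - i₁ + 1 : ℤ) : ℝ) * racahSum a b c (i₁ - 1) i₂ +
      ((a + c - i₂ + 1 : ℤ) : ℝ) * racahSum a b c i₁ (i₂ - 1) =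
      ((i₁ + i₂ - a : ℤ) : ℝ) * racahSum a b c i₁ i₂ := by
  -- The certificate is `g k = k * racahTerm a b c (i₁ - 1) i₂ k`, with `k / k!` written as `1 / (k
  -- - 1)!`.
  set g : ℕ → ℝ := fun k => (-1 : ℝ) ^ k * (invFactorial ((k : ℤ) - 1) *
    invFactorial ((a : ℤ) - k) * invFactorial (a + b - i₁ + 1 - k) * invFactorial (i₂ - k) *
    invFactorial (i₁ - 1 - a + k) * invFactorial (c - i₂ + k)) with hg
  have key : ∀ k : ℕ, ((a + b - i₁ + 1 : ℤ) : ℝ) * racahTerm a b c (i₁ - 1) i₂ k +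
      ((a + c - i₂ + 1 : ℤ) : ℝ) * racahTerm a b c i₁ (i₂ - 1) k -
      ((i₁ + i₂ - a : ℤ) : ℝ) * racahTerm a b c i₁ i₂ k = g k - g (k + 1) := by
    intro k
    simp only [racahTerm, hg, Nat.cast_add, Nat.cast_one]
    rw [show (a : ℤ) + b - (i₁ - 1) - k = a + b - i₁ + 1 - k by ring,
      show i₁ - 1 - (a : ℤ) + (k + 1) = i₁ - a + k by ring,
      show i₂ - ((k : ℤ) + 1) = i₂ - 1 - k by ring,
      show (a : ℤ) + b - i₁ + 1 - (k + 1) = a + b - i₁ - k by ring,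
      show c - (i₂ - 1) + (k : ℤ) = c - i₂ + (k + 1) by ring,
      show (k : ℤ) + 1 - 1 = k by ring,
      invFactorial_sub_one (show (a : ℤ) + b - i₁ - k = (a + b - i₁ + 1 - k) - 1 by ring),
      invFactorial_sub_one (show i₁ - 1 - (a : ℤ) + k = (i₁ - a + k) - 1 by ring),
      invFactorial_sub_one (show i₂ - 1 - (k : ℤ) = (i₂ - k) - 1 by ring),
      invFactorial_sub_one (show c - i₂ + (k : ℤ) = (c - i₂ + (k + 1)) - 1 by ring),
      invFactorial_sub_one (show (k : ℤ) - 1 = k - 1 by ring),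
      invFactorial_sub_one (show (a : ℤ) - (k + 1) = (a - k) - 1 by ring)]
    push_cast
    ring
  have hsum := Finset.sum_congr (rfl : Finset.range (a + 1) = _) fun k _ => key k
  rw [Finset.sum_range_sub', Finset.sum_sub_distrib, Finset.sum_add_distrib, ← Finset.mul_sum,
    ← Finset.mul_sum, ← Finset.mul_sum] at hsum
  have h0 : g 0 = 0 := by
    simp only [hg]; rw [invFactorial_of_neg (n := ((0 : ℕ) : ℤ) - 1) (by simp)]; ring
  have h1 : g (a + 1) = 0 := by
    simp only [hg]; rw [invFactorial_of_neg (n := (a : ℤ) - ((a + 1 : ℕ) : ℤ)) (by simp)]; ring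
  rw [h0, h1, sub_zero] at hsum
  exact sub_eq_zero.1 hsum

/-- The substitution `k ↦ a - k` permutes the six inverse factorials and contributes the sign. It is
the symmetry `j ↦ -j`, which turns raising into lowering. -/
theorem racahSum_rev (a : ℕ) (b c i₁ i₂ : ℤ) :
    racahSum a b c (a + b - i₁) (a + c - i₂) = (-1) ^ a * racahSum a b c i₁ i₂ := by
  rw [racahSum, ← Finset.sum_range_reflect, racahSum, Finset.mul_sum]
  refine Finset.sum_congr rfl fun k hk => ?_
  have hk : k ≤ a := Nat.lt_succ_iff.1 (Finset.mem_range.1 hk)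
  have hs : (-1 : ℝ) ^ (a - k) = (-1) ^ a * (-1) ^ k := by
    rw [← pow_add, show a + k = (a - k) + 2 * k by omega, pow_add, pow_mul]; simp
  simp only [racahTerm]
  rw [show a + 1 - 1 - k = a - k by omega, hs, Nat.cast_sub hk,
    show (a : ℤ) - (a - k) = k by ring,
    show (a : ℤ) + b - (a + b - i₁) - (a - k) = i₁ - a + k by ring,
    show (a : ℤ) + c - i₂ - (a - k) = c - i₂ + k by ring,
    show (a : ℤ) + b - i₁ - a + (a - k) = a + b - i₁ - k by ring,
    show c - ((a : ℤ) + c - i₂) + (a - k) = i₂ - k by ring]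
  ring

/-- In every summand some factorial argument is negative. In the last case, `a + b - i₁ - k` and `c
- i₂ + k` have a negative sum, so one of them is negative. -/
theorem racahSum_eq_zero {a : ℕ} {b c i₁ i₂ : ℤ}
    (h : i₁ < 0 ∨ i₂ < 0 ∨ a + b + c < i₁ + i₂) : racahSum a b c i₁ i₂ = 0 := by
  refine Finset.sum_eq_zero fun k hk => ?_
  have hk : k ≤ a := Nat.lt_succ_iff.1 (Finset.mem_range.1 hk)
  rw [racahTerm]
  rcases h with h | h | h
  · rw [invFactorial_of_neg (n := i₁ - a + k) (by omega)]; ring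
  · rw [invFactorial_of_neg (n := i₂ - k) (by omega)]; ring
  · by_cases h' : a + b - i₁ - k < 0
    · rw [invFactorial_of_neg h']; ring
    · rw [invFactorial_of_neg (n := c - i₂ + k) (by omega)]; ring

/-- Two of the arguments become `p - k` and `k - p`, so only `k = p` survives. -/
theorem racahSum_highest {a b c p : ℕ} (hp : p ≤ a) :
    racahSum a b c (a + b - p) (c + p) =
      (-1) ^ p / ((p ! : ℝ) * ((a - p)! : ℝ) * (b ! : ℝ) * (c ! : ℝ)) := by
  rw [racahSum, Finset.sum_eq_single_of_mem p (Finset.mem_range.2 (by omega))]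
  · rw [racahTerm, show (a : ℤ) - p = ((a - p : ℕ) : ℤ) by omega,
      show (a : ℤ) + b - (a + b - p) - p = (0 : ℕ) by simp,
      show (c : ℤ) + p - p = (c : ℕ) by ring,
      show (a : ℤ) + b - p - a + p = (b : ℕ) by ring,
      show (c : ℤ) - (c + p) + p = (0 : ℕ) by simp]
    simp only [invFactorial_natCast]
    simp
    ring
  · intro k hk hkp
    rw [racahTerm]
    rcases lt_or_gt_of_ne hkp with h | h
    · rw [invFactorial_of_neg (n := (c : ℤ) - (c + p) + k) (by omega)]; ring
    · rw [invFactorial_of_neg (n := (a : ℤ) + b - (a + b - p) - k) (by omega)]; ring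

/-! ### Clebsch–Gordan coefficients in terms of the alternating sum -/

/-- The norm of the monomial `x ^ (L - i) y ^ i` up to a factor that depends on `L` only. -/
def weightNorm (L i : ℕ) : ℝ := √((i ! : ℝ) * ((L - i)! : ℝ))

theorem weightNorm_rev {L i : ℕ} (h : i ≤ L) : weightNorm L (L - i) = weightNorm L i := by
  rw [weightNorm, weightNorm, Nat.sub_sub_self h, mul_comm]

/-- Absorbing the raising coefficient into the norm of the weight vector replaces a square root by
an integer factor; thus the recurrence for the coefficients reduces to the one for `racahSum`. -/
theorem sqrt_mul_weightNorm {L i : ℕ} (h : i < L) :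
    √(((i : ℝ) + 1) * ((L : ℝ) - i)) * weightNorm L i = ((L : ℝ) - i) * weightNorm L (i + 1) := by
  obtain ⟨m, rfl⟩ := Nat.exists_eq_add_of_lt h
  have h1 : i + m + 1 - i = m + 1 := by omega
  have h2 : i + m + 1 - (i + 1) = m := by omega
  have h3 : (((i + m + 1 : ℕ) : ℝ) - i) = m + 1 := by push_cast; ring
  rw [weightNorm, weightNorm, h1, h2, h3, ← Real.sqrt_mul (by positivity),
    ← Real.sqrt_sq (show (0 : ℝ) ≤ m + 1 by positivity), ← Real.sqrt_mul (by positivity),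
    Real.sqrt_sq (by positivity), Nat.factorial_succ, Nat.factorial_succ]
  congr 1
  push_cast
  ring

theorem sqrt_mul_weightNorm_succ {L i : ℕ} (h : i < L) :
    √(((i : ℝ) + 1) * ((L : ℝ) - i)) * weightNorm L (i + 1) = ((i : ℝ) + 1) * weightNorm L i := by
  obtain ⟨m, rfl⟩ := Nat.exists_eq_add_of_lt h
  have h1 : i + m + 1 - i = m + 1 := by omega
  have h2 : i + m + 1 - (i + 1) = m := by omega
  have h3 : (((i + m + 1 : ℕ) : ℝ) - i) = m + 1 := by push_cast; ring
  rw [weightNorm, weightNorm, h1, h2, h3, ← Real.sqrt_mul (by positivity),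
    ← Real.sqrt_sq (show (0 : ℝ) ≤ i + 1 by positivity), ← Real.sqrt_mul (by positivity),
    Real.sqrt_sq (by positivity), Nat.factorial_succ, Nat.factorial_succ]
  congr 1
  push_cast
  ring

/-- The factor in Racah's formula that does not depend on the weights. -/
def racahNorm (a b c : ℕ) : ℝ :=
  √(((b + c + 1 : ℕ) : ℝ) * (a ! : ℝ) * (b ! : ℝ) * (c ! : ℝ) / ((a + b + c + 1)! : ℝ))

/-- The triangle and parity conditions say exactly that the three numbers `a`, `b`, `c` of Racah's
formula are naturals. Working with them removes halving and truncated subtraction. -/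
theorem containsType_iff {L₁ L₂ L : ℕ} :
    ContainsType L₁ L₂ L ↔ ∃ a b c : ℕ, L₁ = a + b ∧ L₂ = a + c ∧ L = b + c := by
  constructor
  · rintro ⟨h1, h2, m, hm⟩
    rw [abs_le] at h1
    exact ⟨m.toNat, L₁ - m.toNat, L₂ - m.toNat, by omega, by omega, by omega⟩
  · rintro ⟨a, b, c, rfl, rfl, rfl⟩
    refine ⟨?_, ?_, ⟨a, by push_cast; ring⟩⟩
    · rw [abs_le]; push_cast; constructor <;> omega
    · push_cast; omega

theorem clebschGordan_eq {a b c i₁ i₂ i : ℕ} (h₁ : i₁ ≤ a + b) (h₂ : i₂ ≤ a + c) (h : i ≤ b + c)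
    (hw : i₁ + i₂ = a + i) :
    clebschGordan (a + b) (a + c) (b + c) i₁ i₂ i =
      racahNorm a b c * (weightNorm (b + c) i * weightNorm (a + b) i₁ * weightNorm (a + c) i₂) *
        racahSum a b c i₁ i₂ := by
  have ha : (a + b + (a + c) - (b + c)) / 2 = a := by omega
  have hb : (b + c + (a + b) - (a + c)) / 2 = b := by omega
  have hc : (b + c + (a + c) - (a + b)) / 2 = c := by omega
  have hn : (a + b + (a + c) + (b + c)) / 2 + 1 = a + b + c + 1 := by omega
  have hcond : ContainsType (a + b) (a + c) (b + c) ∧ i₁ ≤ a + b ∧ i₂ ≤ a + c ∧ i ≤ b + c ∧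
      weight (a + b) i₁ + weight (a + c) i₂ = weight (b + c) i :=
    ⟨containsType_iff.2 ⟨a, b, c, rfl, rfl, rfl⟩, h₁, h₂, h, by simp only [weight]; push_cast; omega⟩
  rw [clebschGordan, if_pos hcond]
  simp only [ha, hb, hc, hn, racahNorm, weightNorm, racahSum, racahTerm]
  have e : √(((i ! : ℕ) : ℝ) * (((b + c - i)! : ℕ) : ℝ) * ((i₁ ! : ℕ) : ℝ) *
      (((a + b - i₁)! : ℕ) : ℝ) * ((i₂ ! : ℕ) : ℝ) * (((a + c - i₂)! : ℕ) : ℝ)) =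
      √((i ! : ℝ) * ((b + c - i)! : ℝ)) * √((i₁ ! : ℝ) * ((a + b - i₁)! : ℝ)) *
        √((i₂ ! : ℝ) * ((a + c - i₂)! : ℝ)) := by
    rw [← Real.sqrt_mul (by positivity), ← Real.sqrt_mul (by positivity)]
    congr 1
    ring
  rw [e]
  simp only [Nat.cast_add]

theorem clebschGordan_ne_zero {L₁ L₂ L i₁ i₂ i : ℕ} (h : clebschGordan L₁ L₂ L i₁ i₂ i ≠ 0) :
    ContainsType L₁ L₂ L ∧ i₁ ≤ L₁ ∧ i₂ ≤ L₂ ∧ i ≤ L ∧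
      weight L₁ i₁ + weight L₂ i₂ = weight L i := by
  by_contra h'
  exact h (if_neg h')

theorem clebschGordan_eq_zero_of_add_ne {a b c i₁ i₂ i : ℕ} (hw : i₁ + i₂ ≠ a + i) :
    clebschGordan (a + b) (a + c) (b + c) i₁ i₂ i = 0 := by
  by_contra h
  have := (clebschGordan_ne_zero h).2.2.2.2
  simp only [weight] at this
  push_cast at this
  omega

theorem clebschGordan_eq_zero_of_not_containsType {L₁ L₂ L : ℕ} (h : ¬ ContainsType L₁ L₂ L)
    (i₁ i₂ i : ℕ) : clebschGordan L₁ L₂ L i₁ i₂ i = 0 :=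
  if_neg fun h' => h h'.1

theorem clebschGordan_rev {a b c i₁ i₂ i : ℕ} (h₁ : i₁ ≤ a + b) (h₂ : i₂ ≤ a + c)
    (h : i ≤ b + c) :
    clebschGordan (a + b) (a + c) (b + c) (a + b - i₁) (a + c - i₂) (b + c - i) =
      (-1) ^ a * clebschGordan (a + b) (a + c) (b + c) i₁ i₂ i := by
  by_cases hw : i₁ + i₂ = a + i
  · rw [clebschGordan_eq (by omega) (by omega) (by omega) (by omega),
      clebschGordan_eq h₁ h₂ h hw, weightNorm_rev h, weightNorm_rev h₁, weightNorm_rev h₂,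
      Nat.cast_sub h₁, Nat.cast_sub h₂]
    push_cast
    rw [racahSum_rev]
    ring
  · rw [clebschGordan_eq_zero_of_add_ne (by omega), clebschGordan_eq_zero_of_add_ne hw, mul_zero]

/-- The coefficient of `ψ_{i+1}` in the image of `ψ_i` under the raising operator. -/
def raiseCoeff (L i : ℕ) : ℝ := √(((i : ℝ) + 1) * ((L : ℝ) - i))

theorem raiseCoeff_self (L : ℕ) : raiseCoeff L L = 0 := by simp [raiseCoeff]

theorem raiseCoeff_pos {L i : ℕ} (h : i < L) : 0 < raiseCoeff L i := by
  have : (i : ℝ) < L := by exact_mod_cast h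
  exact Real.sqrt_pos.2 (mul_pos (by positivity) (by linarith))

theorem weightNorm_mul_racahSum_pred_left {a b c i₁ : ℕ} (i₂ : ℤ) (h₁ : i₁ ≤ a + b) :
    (if i₁ = 0 then 0 else raiseCoeff (a + b) (i₁ - 1) * weightNorm (a + b) (i₁ - 1)) *
        racahSum a b c ((i₁ : ℤ) - 1) i₂ =
      weightNorm (a + b) i₁ * (((a + b - i₁ + 1 : ℤ) : ℝ) * racahSum a b c ((i₁ : ℤ) - 1) i₂) := by
  rcases i₁ with _ | i₁
  · rw [racahSum_eq_zero (Or.inl (by simp))]; simp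
  · rw [if_neg (by omega), Nat.add_sub_cancel, raiseCoeff, sqrt_mul_weightNorm (by omega)]
    push_cast
    ring

theorem weightNorm_mul_racahSum_pred_right {a b c i₂ : ℕ} (i₁ : ℤ) (h₂ : i₂ ≤ a + c) :
    (if i₂ = 0 then 0 else raiseCoeff (a + c) (i₂ - 1) * weightNorm (a + c) (i₂ - 1)) *
        racahSum a b c i₁ ((i₂ : ℤ) - 1) =
      weightNorm (a + c) i₂ * (((a + c - i₂ + 1 : ℤ) : ℝ) * racahSum a b c i₁ ((i₂ : ℤ) - 1)) := by
  rcases i₂ with _ | i₂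
  · rw [racahSum_eq_zero (Or.inr (Or.inl (by simp)))]; simp
  · rw [if_neg (by omega), Nat.add_sub_cancel, raiseCoeff, sqrt_mul_weightNorm (by omega)]
    push_cast
    ring

/-- This is one entry of the identity that `β` commutes with the raising operators. Once the norms
are factored out it is `racahSum_raise`. -/
theorem clebschGordan_raise {L₁ L₂ L j₁ j₂ i : ℕ} (h₁ : j₁ ≤ L₁) (h₂ : j₂ ≤ L₂) (h : i ≤ L) :
    (if j₁ = 0 then 0 else raiseCoeff L₁ (j₁ - 1) * clebschGordan L₁ L₂ L (j₁ - 1) j₂ i) +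
      (if j₂ = 0 then 0 else raiseCoeff L₂ (j₂ - 1) * clebschGordan L₁ L₂ L j₁ (j₂ - 1) i) =
      raiseCoeff L i * clebschGordan L₁ L₂ L j₁ j₂ (i + 1) := by
  by_cases hL : ContainsType L₁ L₂ L
  swap
  · simp [clebschGordan_eq_zero_of_not_containsType hL]
  obtain ⟨a, b, c, rfl, rfl, rfl⟩ := containsType_iff.1 hL
  by_cases hw : j₁ + j₂ = a + i + 1
  swap
  · rw [clebschGordan_eq_zero_of_add_ne (i₁ := j₁) (i₂ := j₂) (by omega)]
    split_ifs
    · simp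
    · rw [clebschGordan_eq_zero_of_add_ne (by omega)]; simp
    · rw [clebschGordan_eq_zero_of_add_ne (by omega)]; simp
    · rw [clebschGordan_eq_zero_of_add_ne (by omega), clebschGordan_eq_zero_of_add_ne (by omega)]
      simp
  have e1 : (if j₁ = 0 then 0 else raiseCoeff (a + b) (j₁ - 1) *
      clebschGordan (a + b) (a + c) (b + c) (j₁ - 1) j₂ i) =
      racahNorm a b c * (weightNorm (b + c) i * weightNorm (a + c) j₂) *
        (weightNorm (a + b) j₁ *
          (((a + b - j₁ + 1 : ℤ) : ℝ) * racahSum a b c ((j₁ : ℤ) - 1) j₂)) := by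
    rw [← weightNorm_mul_racahSum_pred_left _ h₁]
    split_ifs with h0
    · simp
    · rw [clebschGordan_eq (by omega) h₂ h (by omega), Nat.cast_sub (by omega)]
      push_cast
      ring
  have e2 : (if j₂ = 0 then 0 else raiseCoeff (a + c) (j₂ - 1) *
      clebschGordan (a + b) (a + c) (b + c) j₁ (j₂ - 1) i) =
      racahNorm a b c * (weightNorm (b + c) i * weightNorm (a + b) j₁) *
        (weightNorm (a + c) j₂ *
          (((a + c - j₂ + 1 : ℤ) : ℝ) * racahSum a b c j₁ ((j₂ : ℤ) - 1))) := by
    rw [← weightNorm_mul_racahSum_pred_right _ h₂]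
    split_ifs with h0
    · simp
    · rw [clebschGordan_eq h₁ (by omega) h (by omega), Nat.cast_sub (n := j₂) (by omega)]
      push_cast
      ring
  have e3 : raiseCoeff (b + c) i * clebschGordan (a + b) (a + c) (b + c) j₁ j₂ (i + 1) =
      racahNorm a b c * (weightNorm (b + c) i * weightNorm (a + b) j₁ * weightNorm (a + c) j₂) *
        (((j₁ + j₂ - a : ℤ) : ℝ) * racahSum a b c j₁ j₂) := by
    rcases h.lt_or_eq with h | rfl
    · rw [clebschGordan_eq h₁ h₂ h (by omega), show ((j₁ : ℤ) + j₂ - a) = i + 1 by omega]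
      have := sqrt_mul_weightNorm_succ h
      push_cast at this
      rw [raiseCoeff]
      push_cast
      linear_combination racahNorm a b c * weightNorm (a + b) j₁ * weightNorm (a + c) j₂ *
        racahSum a b c j₁ j₂ * this
    -- At the top weight `i = b + c` the raising coefficient vanishes on one side, and the
    -- alternating sum on the other since `j₁ + j₂ = a + b + c + 1`.
    · rw [racahSum_eq_zero (Or.inr (Or.inr (by omega))), raiseCoeff_self]
      simp
  rw [e1, e2, e3, ← racahSum_raise]
  ring

/-! ### The column of highest weight. -/

/-- Racah's sum has one term here. The binomial form is chosen so that the squares add up by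
`sum_choose_mul_choose`. -/
theorem clebschGordan_highest {a b c p : ℕ} (hp : p ≤ a) :
    clebschGordan (a + b) (a + c) (b + c) (a + b - p) (c + p) (b + c) =
      (-1) ^ p * √((((b + (a - p)).choose b : ℕ) : ℝ) * (((c + p).choose c : ℕ) : ℝ) /
        (((a + (b + c + 1)).choose a : ℕ) : ℝ)) := by
  rw [clebschGordan_eq (by omega) (by omega) le_rfl (by omega), Nat.cast_sub (by omega)]
  push_cast
  rw [racahSum_highest hp, mul_div_assoc', mul_comm _ ((-1 : ℝ) ^ p), mul_div_assoc]
  congr 1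
  rw [div_eq_iff (by positivity), racahNorm, weightNorm, weightNorm, weightNorm,
    ← Real.sqrt_mul (by positivity), ← Real.sqrt_mul (by positivity),
    ← Real.sqrt_mul (by positivity),
    ← Real.sqrt_sq (show (0 : ℝ) ≤ (p ! : ℝ) * ((a - p)! : ℝ) * (b ! : ℝ) * (c ! : ℝ) by positivity),
    ← Real.sqrt_mul (by positivity)]
  congr 1
  rw [Nat.cast_add_choose, Nat.cast_add_choose, Nat.cast_add_choose,
    show a + b - (a + b - p) = p by omega, show a + c - (c + p) = a - p by omega,
    show b + (a - p) = a + b - p by omega, show b + c - (b + c) = 0 by omega,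
    show a + (b + c + 1) = a + b + c + 1 by omega, Nat.factorial_succ (b + c)]
  push_cast
  field_simp
  simp

/-- Compare the coefficients of `X ^ a` in `(1 - X)^{-(c+1)} (1 - X)^{-(b+1)} = (1 - X)^{-(b+c+2)}`.
-/
theorem sum_choose_mul_choose (b c a : ℕ) :
    ∑ p ∈ Finset.range (a + 1), (b + (a - p)).choose b * (c + p).choose c =
      (a + (b + c + 1)).choose a := by
  have h := congrArg (fun u : (PowerSeries ℤ)ˣ => PowerSeries.coeff a (u : PowerSeries ℤ))
    (PowerSeries.invOneSubPow_add ℤ (c + 1) (b + 1))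
  rw [show c + 1 + (b + 1) = (b + c + 1) + 1 by ring] at h
  simp only [Units.val_mul, PowerSeries.invOneSubPow_val_succ_eq_mk_add_choose,
    PowerSeries.coeff_mul, PowerSeries.coeff_mk,
    Finset.Nat.sum_antidiagonal_eq_sum_range_succ_mk] at h
  rw [add_comm a (b + c + 1), ← Nat.choose_symm_add]
  zify
  rw [h]
  exact Finset.sum_congr rfl fun p _ => by ring

section LieAlgebra

open scoped Kronecker

/-! ### Matrices of the raising, lowering and weight operators -/

/-- The matrix of the raising operator on `H^ℓ`. -/
def raiseMatrix (L : ℕ) : Matrix (Fin (L + 1)) (Fin (L + 1)) ℂ :=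
  Matrix.of fun j i => if (j : ℕ) = i + 1 then (raiseCoeff L i : ℂ) else 0

/-- The matrix of the lowering operator on `H^ℓ`. -/
def lowerMatrix (L : ℕ) : Matrix (Fin (L + 1)) (Fin (L + 1)) ℂ := (raiseMatrix L).transpose

/-- The diagonal matrix of the weights of `H^ℓ`. -/
def weightMatrix (L : ℕ) : Matrix (Fin (L + 1)) (Fin (L + 1)) ℂ :=
  Matrix.diagonal fun i => (weight L i : ℂ)

/-- The Kronecker sum `A ⊗ 1 + 1 ⊗ B`. -/
def kroneckerSum {m n : Type*} [DecidableEq m] [DecidableEq n] (A : Matrix m m ℂ)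
    (B : Matrix n n ℂ) : Matrix (m × n) (m × n) ℂ := A ⊗ₖ 1 + 1 ⊗ₖ B

theorem kroneckerSum_transpose {m n : Type*} [DecidableEq m] [DecidableEq n] (A : Matrix m m ℂ)
    (B : Matrix n n ℂ) :
    (kroneckerSum A B).transpose = kroneckerSum A.transpose B.transpose := by
  simp [kroneckerSum, Matrix.transpose_add, ← Matrix.kroneckerMap_transpose]

theorem sum_kroneckerSum_mul {m n : Type*} [DecidableEq m] [DecidableEq n] [Fintype m] [Fintype n]
    (A : Matrix m m ℂ) (B : Matrix n n ℂ) (p : m × n) (v : m × n → ℂ) :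
    ∑ q, kroneckerSum A B p q * v q =
      ∑ j, A p.1 j * v (j, p.2) + ∑ j, B p.2 j * v (p.1, j) := by
  simp only [kroneckerSum, Matrix.add_apply, add_mul, Finset.sum_add_distrib,
    Matrix.kroneckerMap_apply]
  rw [Fintype.sum_prod_type, Fintype.sum_prod_type_right]
  congr 1
  · refine Finset.sum_congr rfl fun j _ => ?_
    rw [Finset.sum_eq_single p.2 (fun k _ hk => by simp [Matrix.one_apply_ne' hk]) (by simp)]
    simp
  · refine Finset.sum_congr rfl fun j _ => ?_
    rw [Finset.sum_eq_single p.1 (fun k _ hk => by simp [Matrix.one_apply_ne' hk]) (by simp)]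
    simp

theorem kroneckerSum_mul_apply {m n o : Type*} [DecidableEq m] [DecidableEq n] [Fintype m]
    [Fintype n] (A : Matrix m m ℂ) (B : Matrix n n ℂ) (V : Matrix (m × n) o ℂ) (p : m × n) (i : o) :
    (kroneckerSum A B * V) p i =
      ∑ j, A p.1 j * V (j, p.2) i + ∑ j, B p.2 j * V (p.1, j) i := by
  rw [Matrix.mul_apply, sum_kroneckerSum_mul]

theorem sum_raiseMatrix_mul {L i : ℕ} (h : i < L) (f : Fin (L + 1) → ℂ) :
    ∑ j, raiseMatrix L ⟨i + 1, by omega⟩ j * f j = raiseCoeff L i * f ⟨i, by omega⟩ := by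
  rw [Finset.sum_eq_single ⟨i, by omega⟩]
  · simp [raiseMatrix]
  · intro k _ hk
    have : ¬ i = (k : ℕ) := fun h => hk (Fin.ext h.symm)
    simp [raiseMatrix, this]
  · simp

theorem sum_raiseMatrix_mul_natCast {L : ℕ} (j : Fin (L + 1)) (f : ℕ → ℝ) :
    ∑ i : Fin (L + 1), raiseMatrix L j i * (f i : ℂ) =
      ((if (j : ℕ) = 0 then 0 else raiseCoeff L (j - 1) * f (j - 1) : ℝ) : ℂ) := by
  obtain ⟨j, hj⟩ := j
  rcases j with _ | j
  · simp [raiseMatrix]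
  · rw [sum_raiseMatrix_mul (by omega)]
    simp

theorem sum_mul_raiseMatrix_natCast {L : ℕ} (i : Fin (L + 1)) (f : ℕ → ℝ) :
    ∑ j : Fin (L + 1), (f j : ℂ) * raiseMatrix L j i = ((raiseCoeff L i * f (i + 1) : ℝ) : ℂ) := by
  rcases (Nat.lt_succ_iff.1 i.2).lt_or_eq with h | h
  · rw [Finset.sum_eq_single ⟨i + 1, by omega⟩]
    · simp [raiseMatrix, mul_comm]
    · intro k _ hk
      have : ¬ (k : ℕ) = i + 1 := fun h => hk (Fin.ext h)
      simp [raiseMatrix, this]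
    · simp
  · rw [h, raiseCoeff_self]
    simp only [zero_mul, Complex.ofReal_zero]
    refine Finset.sum_eq_zero fun j _ => ?_
    have : ¬ (j : ℕ) = i + 1 := by omega
    simp [raiseMatrix, this]

/-- The matrix of `β^{ℓ₁,ℓ₂}_ℓ`, whose entries are Clebsch–Gordan coefficients. -/
def cgMatrix (L₁ L₂ L : ℕ) : Matrix (Fin (L₁ + 1) × Fin (L₂ + 1)) (Fin (L + 1)) ℂ :=
  Matrix.of fun p i => (clebschGordan L₁ L₂ L p.1 p.2 i : ℂ)

theorem cgMatrix_eq_zero {L₁ L₂ L : ℕ} (h : ¬ ContainsType L₁ L₂ L) : cgMatrix L₁ L₂ L = 0 := by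
  ext p i
  simp [cgMatrix, clebschGordan_eq_zero_of_not_containsType h]

theorem kroneckerSum_raiseMatrix_mul_cgMatrix (L₁ L₂ L : ℕ) :
    kroneckerSum (raiseMatrix L₁) (raiseMatrix L₂) * cgMatrix L₁ L₂ L =
      cgMatrix L₁ L₂ L * raiseMatrix L := by
  ext p i
  rw [kroneckerSum_mul_apply, Matrix.mul_apply]
  simp only [cgMatrix, Matrix.of_apply]
  rw [sum_raiseMatrix_mul_natCast p.1 (fun k => clebschGordan L₁ L₂ L k p.2 i),
    sum_raiseMatrix_mul_natCast p.2 (fun k => clebschGordan L₁ L₂ L p.1 k i),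
    sum_mul_raiseMatrix_natCast i (fun k => clebschGordan L₁ L₂ L p.1 p.2 k),
    ← Complex.ofReal_add, clebschGordan_raise (Nat.lt_succ_iff.1 p.1.2)
      (Nat.lt_succ_iff.1 p.2.2) (Nat.lt_succ_iff.1 i.2)]

theorem raiseMatrix_rev (L : ℕ) :
    (raiseMatrix L).submatrix Fin.revPerm Fin.revPerm = lowerMatrix L := by
  ext j i
  simp only [raiseMatrix, lowerMatrix, Matrix.submatrix_apply, Matrix.of_apply,
    Matrix.transpose_apply, Fin.revPerm_apply, Fin.val_rev]
  by_cases h : (i : ℕ) = j + 1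
  · rw [if_pos h, if_pos (by omega)]
    simp only [raiseCoeff]
    have h1 : ((L + 1 - (i + 1) : ℕ) : ℝ) = (L : ℝ) - j - 1 := by
      rw [Nat.cast_sub (by omega), h]; push_cast; ring
    rw [h1]
    congr 2
    ring
  · rw [if_neg h, if_neg (by omega)]

theorem cgMatrix_rev (a b c : ℕ) :
    (cgMatrix (a + b) (a + c) (b + c)).submatrix (Equiv.prodCongr Fin.revPerm Fin.revPerm)
      Fin.revPerm = (-1 : ℂ) ^ a • cgMatrix (a + b) (a + c) (b + c) := by
  ext p i
  simp only [cgMatrix, Matrix.submatrix_apply, Matrix.of_apply, Equiv.prodCongr_apply, Prod.map,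
    Fin.revPerm_apply, Fin.val_rev, Nat.reduceSubDiff, Matrix.smul_apply, smul_eq_mul]
  rw [clebschGordan_rev (Nat.lt_succ_iff.1 p.1.2) (Nat.lt_succ_iff.1 p.2.2)
    (Nat.lt_succ_iff.1 i.2)]
  push_cast
  rfl

theorem kroneckerSum_submatrix {m n : Type*} [DecidableEq m] [DecidableEq n] (A : Matrix m m ℂ)
    (B : Matrix n n ℂ) (σ : m ≃ m) (τ : n ≃ n) :
    (kroneckerSum A B).submatrix (Equiv.prodCongr σ τ) (Equiv.prodCongr σ τ) =
      kroneckerSum (A.submatrix σ σ) (B.submatrix τ τ) := by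
  ext p q
  simp [kroneckerSum, Matrix.one_apply]

/-- Reversing the order of the weights exchanges raising with lowering and changes the
Clebsch–Gordan matrix only by a sign, so the raising identity implies this one. -/
theorem kroneckerSum_lowerMatrix_mul_cgMatrix (L₁ L₂ L : ℕ) :
    kroneckerSum (lowerMatrix L₁) (lowerMatrix L₂) * cgMatrix L₁ L₂ L =
      cgMatrix L₁ L₂ L * lowerMatrix L := by
  by_cases hL : ContainsType L₁ L₂ L
  swap
  · simp [cgMatrix_eq_zero hL]
  obtain ⟨a, b, c, rfl, rfl, rfl⟩ := containsType_iff.1 hL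
  -- The extra factor `(-1) ^ a` cancels the sign from `cgMatrix_rev` on both sides.
  have h := congrArg (fun N => (-1 : ℂ) ^ a • N.submatrix
      (Equiv.prodCongr Fin.revPerm Fin.revPerm) Fin.revPerm)
    (kroneckerSum_raiseMatrix_mul_cgMatrix (a + b) (a + c) (b + c))
  rw [← Matrix.submatrix_mul_equiv _ _ _ (Equiv.prodCongr Fin.revPerm Fin.revPerm),
    ← Matrix.submatrix_mul_equiv _ _ _ Fin.revPerm, kroneckerSum_submatrix, raiseMatrix_rev,
    raiseMatrix_rev, raiseMatrix_rev, cgMatrix_rev, Matrix.mul_smul, Matrix.smul_mul, smul_smul,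
    smul_smul, ← mul_pow] at h
  simpa using h

theorem kroneckerSum_weightMatrix_mul_cgMatrix (L₁ L₂ L : ℕ) :
    kroneckerSum (weightMatrix L₁) (weightMatrix L₂) * cgMatrix L₁ L₂ L =
      cgMatrix L₁ L₂ L * weightMatrix L := by
  ext p i
  rw [kroneckerSum_mul_apply, weightMatrix, weightMatrix, weightMatrix, Matrix.mul_diagonal]
  simp only [Matrix.diagonal_apply, ite_mul, zero_mul, Finset.sum_ite_eq, Finset.mem_univ,
    if_true, cgMatrix, Matrix.of_apply]
  by_cases h : clebschGordan L₁ L₂ L p.1 p.2 i = 0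
  · simp [h]
  · rw [← add_mul, ← Int.cast_add, (clebschGordan_ne_zero h).2.2.2.2, mul_comm]

/-! ### Multiplicity one -/

/-- `A : H^ℓ → H^{ℓ₁,ℓ₂}` commutes with the action of the Lie algebra. -/
structure IsIntertwiner {L₁ L₂ L : ℕ}
    (A : Matrix (Fin (L₁ + 1) × Fin (L₂ + 1)) (Fin (L + 1)) ℂ) : Prop where
  raise : kroneckerSum (raiseMatrix L₁) (raiseMatrix L₂) * A = A * raiseMatrix L
  lower : kroneckerSum (lowerMatrix L₁) (lowerMatrix L₂) * A = A * lowerMatrix L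
  wt : kroneckerSum (weightMatrix L₁) (weightMatrix L₂) * A = A * weightMatrix L

theorem isIntertwiner_cgMatrix (L₁ L₂ L : ℕ) : IsIntertwiner (cgMatrix L₁ L₂ L) :=
  ⟨kroneckerSum_raiseMatrix_mul_cgMatrix L₁ L₂ L, kroneckerSum_lowerMatrix_mul_cgMatrix L₁ L₂ L,
    kroneckerSum_weightMatrix_mul_cgMatrix L₁ L₂ L⟩

namespace IsIntertwiner

variable {L₁ L₂ L : ℕ} {A B : Matrix (Fin (L₁ + 1) × Fin (L₂ + 1)) (Fin (L + 1)) ℂ}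

theorem sub (hA : IsIntertwiner A) (hB : IsIntertwiner B) : IsIntertwiner (A - B) := by
  constructor
  · rw [Matrix.mul_sub, Matrix.sub_mul, hA.raise, hB.raise]
  · rw [Matrix.mul_sub, Matrix.sub_mul, hA.lower, hB.lower]
  · rw [Matrix.mul_sub, Matrix.sub_mul, hA.wt, hB.wt]

theorem smul (hA : IsIntertwiner A) (c : ℂ) : IsIntertwiner (c • A) := by
  constructor
  · rw [Matrix.mul_smul, Matrix.smul_mul, hA.raise]
  · rw [Matrix.mul_smul, Matrix.smul_mul, hA.lower]
  · rw [Matrix.mul_smul, Matrix.smul_mul, hA.wt]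

theorem weight_eq (hA : IsIntertwiner A) {p : Fin (L₁ + 1) × Fin (L₂ + 1)} {i : Fin (L + 1)}
    (h : A p i ≠ 0) : weight L₁ p.1 + weight L₂ p.2 = weight L i := by
  have h1 := congrFun (congrFun hA.wt p) i
  rw [kroneckerSum_mul_apply, weightMatrix, weightMatrix, weightMatrix, Matrix.mul_diagonal] at h1
  simp only [Matrix.diagonal_apply, ite_mul, zero_mul, Finset.sum_ite_eq, Finset.mem_univ,
    if_true, Prod.mk.eta] at h1
  rw [← add_mul, mul_comm (A p i)] at h1
  exact_mod_cast mul_right_cancel₀ h h1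

theorem sum_raise_eq_zero (hA : IsIntertwiner A) (p : Fin (L₁ + 1) × Fin (L₂ + 1)) :
    ∑ j, raiseMatrix L₁ p.1 j * A (j, p.2) (Fin.last L) +
      ∑ j, raiseMatrix L₂ p.2 j * A (p.1, j) (Fin.last L) = 0 := by
  rw [← kroneckerSum_mul_apply, hA.raise, Matrix.mul_apply]
  refine Finset.sum_eq_zero fun j _ => ?_
  have : ¬ (j : ℕ) = L + 1 := by omega
  simp [raiseMatrix, this]

/-- The last column is annihilated by raising. Row `(s + 1, j)` of that equation expresses entry
`(s, j)` through entries with first index `s + 1`, so vanishing propagates down from the top first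
index. -/
theorem last_eq_zero_of_left (hA : IsIntertwiner A)
    (h : ∀ j, A (Fin.last L₁, j) (Fin.last L) = 0) (p : Fin (L₁ + 1) × Fin (L₂ + 1)) :
    A p (Fin.last L) = 0 := by
  suffices ∀ n ≤ L₁, ∀ j, A (⟨L₁ - n, by omega⟩, j) (Fin.last L) = 0 by
    obtain ⟨⟨i, hi⟩, j⟩ := p
    have := this (L₁ - i) (by omega) j
    simpa only [show L₁ - (L₁ - i) = i by omega] using this
  intro n
  induction n with
  | zero => exact fun _ => h
  | succ n ih =>
    intro hn j
    have h1 := hA.sum_raise_eq_zero (⟨L₁ - (n + 1) + 1, by omega⟩, j)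
    rw [sum_raiseMatrix_mul (by omega) (fun k => A (k, j) (Fin.last L)),
      Finset.sum_eq_zero fun k _ => ?_, add_zero] at h1
    · refine (mul_eq_zero.1 h1).resolve_left ?_
      exact_mod_cast (raiseCoeff_pos (by omega)).ne'
    · simp only [show L₁ - (n + 1) + 1 = L₁ - n by omega]
      rw [ih (by omega), mul_zero]

theorem last_eq_zero_of_right (hA : IsIntertwiner A)
    (h : ∀ j, A (j, Fin.last L₂) (Fin.last L) = 0) (p : Fin (L₁ + 1) × Fin (L₂ + 1)) :
    A p (Fin.last L) = 0 := by
  suffices ∀ n ≤ L₂, ∀ j, A (j, ⟨L₂ - n, by omega⟩) (Fin.last L) = 0 by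
    obtain ⟨j, ⟨i, hi⟩⟩ := p
    have := this (L₂ - i) (by omega) j
    simpa only [show L₂ - (L₂ - i) = i by omega] using this
  intro n
  induction n with
  | zero => exact fun _ => h
  | succ n ih =>
    intro hn j
    have h1 := hA.sum_raise_eq_zero (j, ⟨L₂ - (n + 1) + 1, by omega⟩)
    rw [sum_raiseMatrix_mul (by omega) (fun k => A (j, k) (Fin.last L)),
      Finset.sum_eq_zero fun k _ => ?_, zero_add] at h1
    · refine (mul_eq_zero.1 h1).resolve_left ?_
      exact_mod_cast (raiseCoeff_pos (by omega)).ne'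
    · simp only [show L₂ - (n + 1) + 1 = L₂ - n by omega]
      rw [ih (by omega), mul_zero]

/-- The highest weight vector generates `H^ℓ` under lowering, and the lowering coefficients do not
vanish. -/
theorem eq_zero_of_last (hA : IsIntertwiner A) (h : ∀ p, A p (Fin.last L) = 0) : A = 0 := by
  suffices ∀ n ≤ L, ∀ p, A p ⟨L - n, by omega⟩ = 0 by
    ext p ⟨i, hi⟩
    have := this (L - i) (by omega) p
    rw [Matrix.zero_apply]
    simpa only [show L - (L - i) = i by omega] using this
  intro n
  induction n with
  | zero => exact fun _ => h
  | succ n ih =>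
    intro hn p
    have h1 := congrFun (congrFun hA.lower p) ⟨L - (n + 1) + 1, by omega⟩
    have h2 : ∀ q, A q ⟨L - (n + 1) + 1, by omega⟩ = 0 := by
      simp only [show L - (n + 1) + 1 = L - n by omega]
      exact ih (by omega)
    rw [kroneckerSum_mul_apply, Matrix.mul_apply] at h1
    simp only [h2, mul_zero, Finset.sum_const_zero, add_zero, lowerMatrix,
      Matrix.transpose_apply, mul_comm (A p _)] at h1
    rw [sum_raiseMatrix_mul (by omega)] at h1
    refine (mul_eq_zero.1 h1.symm).resolve_left ?_
    exact_mod_cast (raiseCoeff_pos (by omega)).ne'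

/-- A non-zero highest weight vector has a non-zero component with top first weight and another with
top second weight. The weight conditions on these two components yield the triangle inequalities and
the parity. -/
theorem eq_zero_of_not_containsType (hA : IsIntertwiner A) (h : ¬ ContainsType L₁ L₂ L) :
    A = 0 := by
  refine hA.eq_zero_of_last ?_
  by_cases h1 : ∀ j, A (Fin.last L₁, j) (Fin.last L) = 0
  · exact hA.last_eq_zero_of_left h1
  by_cases h2 : ∀ j, A (j, Fin.last L₂) (Fin.last L) = 0
  · exact hA.last_eq_zero_of_right h2
  push Not at h1 h2
  obtain ⟨j₂, h1⟩ := h1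
  obtain ⟨j₁, h2⟩ := h2
  have w1 := hA.weight_eq h1
  have w2 := hA.weight_eq h2
  simp only [weight, Fin.val_last] at w1 w2
  refine absurd ?_ h
  refine ⟨abs_le.2 ⟨by omega, by omega⟩, by omega, ⟨(L₁ : ℤ) - j₁, by omega⟩⟩

/-- When the first weight is at its top, weight conservation leaves only the second index `c`. One
entry therefore controls the whole intertwiner, which is multiplicity one. -/
theorem eq_zero_of_apply {a b c : ℕ}
    {A : Matrix (Fin (a + b + 1) × Fin (a + c + 1)) (Fin (b + c + 1)) ℂ} (hA : IsIntertwiner A)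
    (h : A (Fin.last _, ⟨c, by omega⟩) (Fin.last _) = 0) : A = 0 := by
  refine hA.eq_zero_of_last (hA.last_eq_zero_of_left fun j => ?_)
  by_contra hj
  have w := hA.weight_eq hj
  simp only [weight, Fin.val_last] at w
  have : j = ⟨c, by omega⟩ := Fin.ext (by push_cast at w; simp only; omega)
  exact hj (this ▸ h)

end IsIntertwiner

/-! ### Normalisation of the highest-weight column and the multiplicity-one scalar. -/

theorem clebschGordan_highest_pos (a b c : ℕ) :
    0 < clebschGordan (a + b) (a + c) (b + c) (a + b) c (b + c) := by
  have h := clebschGordan_highest (b := b) (c := c) (Nat.zero_le a)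
  simp only [Nat.sub_zero, add_zero, pow_zero, one_mul] at h
  rw [h]
  have h1 : 0 < (b + a).choose b := Nat.choose_pos (by omega)
  have h2 : 0 < c.choose c := Nat.choose_pos (by omega)
  have h3 : 0 < (a + (b + c + 1)).choose a := Nat.choose_pos (by omega)
  exact Real.sqrt_pos.2 (by positivity)

theorem sum_clebschGordan_highest_sq (a b c : ℕ) :
    ∑ p : Fin (a + b + 1) × Fin (a + c + 1),
      clebschGordan (a + b) (a + c) (b + c) p.1 p.2 (b + c) ^ 2 = 1 := by
  have h : ∑ p : Fin (a + 1), clebschGordan (a + b) (a + c) (b + c) (a + b - p) (c + p) (b + c) ^ 2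
      = ∑ p : Fin (a + b + 1) × Fin (a + c + 1),
        clebschGordan (a + b) (a + c) (b + c) p.1 p.2 (b + c) ^ 2 := by
    -- Weight conservation puts the support of the column inside the image of `p ↦ (a + b - p, c +
    -- p)`.
    refine Finset.sum_of_injOn
      (fun p => (⟨a + b - p, by omega⟩, ⟨c + p, by omega⟩)) ?_ (by simp [Set.MapsTo]) ?_ ?_
    · intro p _ q _ hpq
      simp only [Prod.mk.injEq, Fin.mk.injEq] at hpq
      exact Fin.ext (by omega)
    · rintro ⟨i, j⟩ _ hp
      by_contra h0
      have hw := (clebschGordan_ne_zero (pow_ne_zero_iff two_ne_zero |>.1 h0)).2.2.2.2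
      simp only [weight] at hw
      push_cast at hw
      refine hp ⟨⟨a + b - i, by omega⟩, by simp, ?_⟩
      ext <;> simp only <;> omega
    · exact fun _ _ => rfl
  rw [← h, Fin.sum_univ_eq_sum_range
    (fun p => clebschGordan (a + b) (a + c) (b + c) (a + b - p) (c + p) (b + c) ^ 2)]
  have hpos : 0 < (a + (b + c + 1)).choose a := Nat.choose_pos (by omega)
  have hpos' : (0 : ℝ) < ((a + (b + c + 1)).choose a : ℕ) := by exact_mod_cast hpos
  calc _ = ∑ p ∈ Finset.range (a + 1), (((b + (a - p)).choose b : ℕ) : ℝ) *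
        (((c + p).choose c : ℕ) : ℝ) / (((a + (b + c + 1)).choose a : ℕ) : ℝ) := by
        refine Finset.sum_congr rfl fun p hp => ?_
        rw [clebschGordan_highest (Nat.lt_succ_iff.1 (Finset.mem_range.1 hp)), mul_pow,
          Real.sq_sqrt (by positivity), ← pow_mul, mul_comm p, pow_mul]
        simp
    _ = 1 := by
        rw [← Finset.sum_div, div_eq_one_iff_eq hpos'.ne']
        exact_mod_cast sum_choose_mul_choose b c a

/-- An intertwiner `H^ℓ → H^{ℓ₁,ℓ₂}` is a multiple of the Clebsch–Gordan matrix. -/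
theorem IsIntertwiner.eq_smul_cgMatrix {L₁ L₂ L : ℕ}
    {A : Matrix (Fin (L₁ + 1) × Fin (L₂ + 1)) (Fin (L + 1)) ℂ} (hA : IsIntertwiner A) :
    A = (∑ p, A p (Fin.last L) * cgMatrix L₁ L₂ L p (Fin.last L)) • cgMatrix L₁ L₂ L := by
  by_cases hL : ContainsType L₁ L₂ L
  swap
  · rw [cgMatrix_eq_zero hL, smul_zero, hA.eq_zero_of_not_containsType hL]
  obtain ⟨a, b, c, rfl, rfl, rfl⟩ := containsType_iff.1 hL
  set B := cgMatrix (a + b) (a + c) (b + c)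
  have hB : B (Fin.last _, ⟨c, by omega⟩) (Fin.last _) ≠ 0 := by
    have := (clebschGordan_highest_pos a b c).ne'
    simp only [B, cgMatrix, Matrix.of_apply, Fin.val_last]
    exact_mod_cast this
  -- The scalar is chosen to cancel the entry that controls the intertwiner, so `eq_zero_of_apply`
  -- kills the difference.
  obtain ⟨r, hr⟩ : ∃ r : ℂ, A = r • B := by
    refine ⟨A (Fin.last _, ⟨c, by omega⟩) (Fin.last _) /
      B (Fin.last _, ⟨c, by omega⟩) (Fin.last _), sub_eq_zero.1 ?_⟩
    refine (hA.sub ((isIntertwiner_cgMatrix _ _ _).smul _)).eq_zero_of_apply ?_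
    rw [Matrix.sub_apply, Matrix.smul_apply, smul_eq_mul, div_mul_cancel₀ _ hB, sub_self]
  have hsum : ∑ p, B p (Fin.last _) * B p (Fin.last _) = 1 := by
    have := sum_clebschGordan_highest_sq a b c
    simp only [B, cgMatrix, Matrix.of_apply, Fin.val_last]
    simp only [sq] at this
    exact_mod_cast this
  have : ∑ p, A p (Fin.last _) * B p (Fin.last _) = r := by
    rw [hr]
    simp only [Matrix.smul_apply, smul_eq_mul, mul_assoc]
    rw [← Finset.mul_sum, hsum, mul_one]
  rw [this, hr]

end LieAlgebra

/-! ### Tensor products with the two-dimensional representation -/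

theorem clebschGordan_one_up_zero {L s : ℕ} (h : s ≤ L) :
    clebschGordan L 1 (L + 1) s 0 s = √(((L : ℝ) + 1 - s) / (L + 1)) := by
  have e := clebschGordan_eq (a := 0) (b := L) (c := 1) (i₁ := s) (i₂ := 0) (i := s)
    (by omega) (by omega) (by omega) (by omega)
  simp only [zero_add] at e
  obtain ⟨m, rfl⟩ := Nat.exists_eq_add_of_le h
  have h4 : invFactorial (1 : ℤ) = 1 := by simpa using invFactorial_natCast 1
  have h5 : invFactorial (0 : ℤ) = 1 := by simpa using invFactorial_natCast 0
  -- Written as the root of a square, this value can be merged with the other factors under a single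
  -- root.
  have hS : racahSum 0 ((s + m : ℕ) : ℤ) (1 : ℕ) s (0 : ℕ) = √((1 / ((s ! : ℝ) * (m ! : ℝ))) ^ 2) := by
    rw [Real.sqrt_sq (by positivity)]
    simp [racahSum, racahTerm, h4, h5]
    rw [invFactorial_natCast, invFactorial_natCast]
    ring
  rw [e, hS, racahNorm, weightNorm, weightNorm, weightNorm,
    ← Real.sqrt_mul (by positivity), ← Real.sqrt_mul (by positivity),
    ← Real.sqrt_mul (by positivity), ← Real.sqrt_mul (by positivity)]
  congr 1
  rw [show s + m + 1 - s = m + 1 by omega, show s + m - s = m by omega,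
    show 0 + (s + m) + 1 + 1 = (s + m) + 1 + 1 by ring]
  simp only [Nat.factorial_succ, Nat.factorial_zero]
  push_cast
  field_simp
  ring

theorem clebschGordan_one_up_one {L s : ℕ} (h : s ≤ L) :
    clebschGordan L 1 (L + 1) s 1 (s + 1) = √(((s : ℝ) + 1) / (L + 1)) := by
  have e := clebschGordan_rev (a := 0) (b := L) (c := 1) (i₁ := L - s) (i₂ := 0) (i := L - s)
    (by omega) (by omega) (by omega)
  simp only [zero_add, pow_zero, one_mul, Nat.sub_sub_self h, Nat.sub_zero,
    show L + 1 - (L - s) = s + 1 by omega] at e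
  rw [e, clebschGordan_one_up_zero (by omega), Nat.cast_sub h]
  congr 2
  ring

theorem clebschGordan_one_down_zero {M s : ℕ} (h : s ≤ M) :
    clebschGordan (M + 1) 1 M (s + 1) 0 s = √(((s : ℝ) + 1) / (M + 2)) := by
  have e := clebschGordan_eq (a := 1) (b := M) (c := 0) (i₁ := s + 1) (i₂ := 0) (i := s)
    (by omega) (by omega) (by omega) (by omega)
  obtain ⟨m, rfl⟩ := Nat.exists_eq_add_of_le h
  have h4 : invFactorial (1 : ℤ) = 1 := by simpa using invFactorial_natCast 1
  have h5 : invFactorial (0 : ℤ) = 1 := by simpa using invFactorial_natCast 0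
  have h6 : invFactorial (-1 : ℤ) = 0 := invFactorial_of_neg (by norm_num)
  have hS : racahSum 1 ((s + m : ℕ) : ℤ) (0 : ℕ) ((s + 1 : ℕ) : ℤ) (0 : ℕ) =
      √((1 / ((s ! : ℝ) * (m ! : ℝ))) ^ 2) := by
    rw [Real.sqrt_sq (by positivity)]
    simp [racahSum, racahTerm, Finset.sum_range_succ, h4, h5, h6]
    rw [show 1 + ((s : ℤ) + m) - (s + 1) = (m : ℕ) by ring, invFactorial_natCast,
      invFactorial_natCast]
    ring
  rw [add_comm (s + m) 1]
  rw [add_zero, add_zero] at e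
  rw [e, hS, racahNorm, weightNorm, weightNorm, weightNorm,
    ← Real.sqrt_mul (by positivity), ← Real.sqrt_mul (by positivity),
    ← Real.sqrt_mul (by positivity), ← Real.sqrt_mul (by positivity)]
  congr 1
  rw [show s + m - s = m by omega, show 1 + (s + m) - (s + 1) = m by omega,
    show 1 + (s + m) + 0 + 1 = (s + m) + 1 + 1 by ring]
  simp only [Nat.factorial_succ, Nat.factorial_zero]
  push_cast
  field_simp
  ring

theorem clebschGordan_one_down_one {M s : ℕ} (h : s ≤ M) :
    clebschGordan (M + 1) 1 M s 1 s = -√(((M : ℝ) + 1 - s) / (M + 2)) := by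
  have e := clebschGordan_rev (a := 1) (b := M) (c := 0) (i₁ := M - s + 1) (i₂ := 0) (i := M - s)
    (by omega) (by omega) (by omega)
  simp only [add_zero, pow_one, Nat.sub_sub_self h, Nat.sub_zero, add_comm 1 M,
    show M + 1 - (M - s + 1) = s by omega] at e
  rw [e, clebschGordan_one_down_zero (by omega), Nat.cast_sub h]
  simp only [neg_mul, one_mul, neg_inj]
  congr 2
  ring

theorem clebschGordan_one_up_eq_zero {L s t i : ℕ} (h : i ≠ s + t) :
    clebschGordan L 1 (L + 1) s t i = 0 := by
  by_contra h0
  have := (clebschGordan_ne_zero h0).2.2.2.2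
  simp only [weight] at this
  push_cast at this
  omega

theorem clebschGordan_one_down_eq_zero {M s t i : ℕ} (h : i + 1 ≠ s + t) :
    clebschGordan (M + 1) 1 M s t i = 0 := by
  by_contra h0
  have := (clebschGordan_ne_zero h0).2.2.2.2
  simp only [weight] at this
  push_cast at this
  omega

/-! ### Completeness of the decomposition of spin `ℓ` tensor spin `1/2`. -/

theorem neighbours_zero : neighbours 0 = {1} := by
  ext M
  simp only [neighbours, Finset.mem_filter, Finset.mem_range, Finset.mem_singleton]
  constructor
  · rintro ⟨h, h1, -, -⟩
    rw [abs_le] at h1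
    push_cast at h1
    omega
  · rintro rfl
    exact ⟨by omega, containsType_iff.2 ⟨0, 0, 1, rfl, rfl, rfl⟩⟩

theorem neighbours_succ (L : ℕ) : neighbours (L + 1) = {L, L + 2} := by
  ext M
  simp only [neighbours, Finset.mem_filter, Finset.mem_range, Finset.mem_singleton,
    Finset.mem_insert]
  constructor
  · rintro ⟨h, h1, h2, k, hk⟩
    rw [abs_le] at h1
    push_cast at h1 h2 hk
    omega
  · rintro (rfl | rfl)
    · exact ⟨by omega, containsType_iff.2 ⟨1, M, 0, by ring, rfl, rfl⟩⟩
    · exact ⟨by omega, containsType_iff.2 ⟨0, L + 1, 1, by ring, rfl, rfl⟩⟩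

theorem sum_clebschGordan_up (L : ℕ) {s s' : ℕ} (t t' : ℕ) (hs : s + t ≤ L + 1) :
    ∑ i : Fin (L + 1 + 1), clebschGordan L 1 (L + 1) s t i * clebschGordan L 1 (L + 1) s' t' i =
      clebschGordan L 1 (L + 1) s t (s + t) * clebschGordan L 1 (L + 1) s' t' (s + t) := by
  rw [Finset.sum_eq_single ⟨s + t, by omega⟩ _ (by simp)]
  intro i _ hi
  rw [clebschGordan_one_up_eq_zero (fun h => hi (Fin.ext h)), zero_mul]

theorem sum_clebschGordan_down (M : ℕ) {s s' i : ℕ} (t t' : ℕ) (hi : i ≤ M) (hs : i + 1 = s + t) :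
    ∑ i : Fin (M + 1), clebschGordan (M + 1) 1 M s t i * clebschGordan (M + 1) 1 M s' t' i =
      clebschGordan (M + 1) 1 M s t i * clebschGordan (M + 1) 1 M s' t' i := by
  rw [Finset.sum_eq_single ⟨i, by omega⟩ _ (by simp)]
  intro j _ hj
  rw [clebschGordan_one_down_eq_zero (fun h => hj (Fin.ext (by simp only; omega))), zero_mul]

theorem sum_clebschGordan_down_eq_zero (M : ℕ) {s t : ℕ} (s' t' : ℕ)
    (h : ∀ i ≤ M, i + 1 ≠ s + t) :
    ∑ i : Fin (M + 1), clebschGordan (M + 1) 1 M s t i * clebschGordan (M + 1) 1 M s' t' i = 0 :=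
  Finset.sum_eq_zero fun i _ => by
    rw [clebschGordan_one_down_eq_zero (h i (Nat.lt_succ_iff.1 i.2)), zero_mul]

theorem sum_clebschGordan_eq_zero {L₁ L₂ L s t s' t' : ℕ}
    (h : weight L₁ s + weight L₂ t ≠ weight L₁ s' + weight L₂ t') :
    ∑ i : Fin (L + 1), clebschGordan L₁ L₂ L s t i * clebschGordan L₁ L₂ L s' t' i = 0 := by
  refine Finset.sum_eq_zero fun i _ => ?_
  by_contra h0
  exact h ((clebschGordan_ne_zero (left_ne_zero_of_mul h0)).2.2.2.2.trans
    (clebschGordan_ne_zero (right_ne_zero_of_mul h0)).2.2.2.2.symm)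

/-- Different total weights do not meet. Within an interior total weight the coefficients form a 2 ×
2 orthogonal matrix with entries `√p, √q, √q, -√p` up to order, `p + q = 1`; the two extreme weights
occur in spin `ℓ + 1/2` only. -/
theorem sum_neighbours_clebschGordan {L s s' : ℕ} (hs : s ≤ L) (hs' : s' ≤ L) (t t' : Fin 2) :
    ∑ M ∈ neighbours L, ∑ i : Fin (M + 1),
      clebschGordan L 1 M s t i * clebschGordan L 1 M s' t' i =
        if s = s' ∧ t = t' then 1 else 0 := by
  by_cases hst : s + t ≠ s' + t'
  · rw [if_neg (by rintro ⟨rfl, rfl⟩; exact hst rfl)]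
    refine Finset.sum_eq_zero fun M _ => sum_clebschGordan_eq_zero ?_
    simp only [weight]
    omega
  rw [not_ne_iff] at hst
  have hup : ∑ i : Fin (L + 1 + 1), clebschGordan L 1 (L + 1) s t i *
      clebschGordan L 1 (L + 1) s' t' i = _ := sum_clebschGordan_up L t t' (by omega)
  rcases L with _ | M
  · obtain rfl : s = 0 := by omega
    obtain rfl : s' = 0 := by omega
    obtain rfl : t = t' := Fin.ext (by omega)
    rw [neighbours_zero, Finset.sum_singleton]
    simp only [zero_add] at hup
    rw [hup]
    have h0 := clebschGordan_one_up_zero (le_refl 0)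
    have h1 := clebschGordan_one_up_one (le_refl 0)
    norm_num at h0 h1
    fin_cases t <;> simp [h0, h1]
  have hM : (0 : ℝ) < M + 2 := by positivity
  have hM2 : ((M + 1 : ℕ) : ℝ) + 1 = M + 2 := by push_cast; ring
  rw [neighbours_succ, Finset.sum_pair (by omega)]
  rw [show M + 2 = M + 1 + 1 by ring, hup]
  have hsM : (s : ℝ) ≤ M + 1 := by exact_mod_cast hs
  have hsM' : (s' : ℝ) ≤ M + 1 := by exact_mod_cast hs'
  fin_cases t <;> fin_cases t' <;> simp only [Fin.zero_eta, Fin.mk_one, add_zero] at hst ⊢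
  · subst hst
    rw [if_pos (by simp), clebschGordan_one_up_zero hs, hM2,
      Real.mul_self_sqrt (div_nonneg (by linarith) hM.le)]
    rcases s with _ | r
    -- The lowest total weight does not occur in spin `ℓ - 1/2`, so the upper spin alone contributes
    -- 1.
    · rw [sum_clebschGordan_down_eq_zero _ _ _ (by omega)]
      field_simp
      simp
    · rw [sum_clebschGordan_down M 0 0 (i := r) (by omega) (by omega),
        clebschGordan_one_down_zero (by omega), Real.mul_self_sqrt (by positivity)]
      push_cast
      field_simp
      ring
  · subst hst
    rw [if_neg (by simp), clebschGordan_one_up_zero hs, clebschGordan_one_up_one hs',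
      sum_clebschGordan_down M 0 1 (i := s') (by omega) (by omega),
      clebschGordan_one_down_zero (by omega), clebschGordan_one_down_one (by omega), hM2]
    push_cast
    ring_nf
  · subst hst
    rw [if_neg (by simp), clebschGordan_one_up_zero hs', clebschGordan_one_up_one hs,
      sum_clebschGordan_down M 1 0 (i := s) (by omega) (by omega),
      clebschGordan_one_down_zero (by omega), clebschGordan_one_down_one (by omega), hM2]
    push_cast
    ring_nf
  · obtain rfl : s = s' := by omega
    rw [if_pos (by simp), clebschGordan_one_up_one hs, hM2, Real.mul_self_sqrt (by positivity)]
    rcases hs.lt_or_eq with h | rfl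
    · rw [sum_clebschGordan_down M 1 1 (i := s) (by omega) (by omega),
        clebschGordan_one_down_one (by omega), neg_mul_neg,
        Real.mul_self_sqrt (div_nonneg (by linarith) hM.le)]
      field_simp
      ring
    · rw [sum_clebschGordan_down_eq_zero _ _ _ (by omega)]
      push_cast
      field_simp
      ring

theorem sum_neighbours_cgMatrix (L : ℕ) :
    ∑ M ∈ neighbours L, cgMatrix L 1 M * (cgMatrix L 1 M).transpose = 1 := by
  ext p q
  have h := sum_neighbours_clebschGordan (Nat.lt_succ_iff.1 p.1.2) (Nat.lt_succ_iff.1 q.1.2)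
    p.2 q.2
  simp only [Matrix.sum_apply, Matrix.mul_apply, Matrix.transpose_apply, cgMatrix,
    Matrix.of_apply, Matrix.one_apply, Prod.ext_iff, Fin.ext_iff] at h ⊢
  simp only [← Complex.ofReal_mul, ← Complex.ofReal_sum, h]
  split_ifs <;> simp

section Equivariance

open MvPolynomial

/-! ### Equivariance of `β^{ℓ,1/2}_m` -/

/-- The chain rule for a linear substitution: the `r`-th new variable has derivative `k s r` along
`X s`. -/
theorem pderiv_substitution (k : Matrix (Fin 2) (Fin 2) ℂ) (s : Fin 2)
    (p : MvPolynomial (Fin 2) ℂ) :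
    pderiv s (substitution k p) = ∑ r, C (k s r) * substitution k (pderiv r p) := by
  induction p using MvPolynomial.induction_on with
  | C a => simp [substitution]
  | add p q hp hq => simp [hp, hq, mul_add, Finset.sum_add_distrib]
  | mul_X p r hp =>
    have hX : pderiv s (substitution k (X r)) = C (k s r) := by
      rw [substitution, aeval_X, map_sum, Finset.sum_eq_single s]
      · simp
      · intro t _ hts
        simp [pderiv_X_of_ne hts]
      · simp
    have hr : ∀ t : Fin 2, pderiv t (X r : MvPolynomial (Fin 2) ℂ) = if r = t then 1 else 0 := by
      intro t
      by_cases h : r = t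
      · subst h; simp
      · rw [if_neg h, pderiv_X_of_ne h]
    simp only [map_mul, Derivation.leibniz, smul_eq_mul, hX, hp, hr, map_add, mul_add,
      Finset.sum_add_distrib, apply_ite (substitution k), map_zero, mul_ite, mul_one,
      mul_zero, Finset.sum_ite_eq, Finset.mem_univ, if_true, Finset.mul_sum]
    congr 1
    · ring
    · exact Finset.sum_congr rfl fun t _ => by ring

/-- The partial derivative `∂_r : H^{ℓ+1/2} → H^ℓ`. -/
def partialMap (L : ℕ) (r : Fin 2) : H (L + 1) →ₗ[ℂ] H L :=
  (pderiv r).toLinearMap.restrict fun _ hp =>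
    (mem_homogeneousSubmodule _ _).2 ((mem_homogeneousSubmodule _ _).1 hp).pderiv

/-- Multiplication by `X r` as a map `H^ℓ → H^{ℓ+1/2}`. -/
def mulVarMap (L : ℕ) (r : Fin 2) : H L →ₗ[ℂ] H (L + 1) :=
  (LinearMap.mulRight ℂ (X r)).restrict fun _ hp =>
    (mem_homogeneousSubmodule _ _).2 (((mem_homogeneousSubmodule _ _).1 hp).mul (isHomogeneous_X _ _))

theorem partialMap_T (L : ℕ) (k : K) (s : Fin 2) (p : H (L + 1)) :
    partialMap L s (T (L + 1) k p) = ∑ r, (k : Matrix _ _ ℂ) s r • T L k (partialMap L r p) := by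
  apply Subtype.ext
  simp only [AddSubmonoidClass.coe_finsetSum, Submodule.coe_smul, smul_eq_C_mul]
  exact pderiv_substitution _ s _

/-- The components of the antisymmetric embedding `p ↦ p y ⊗ x - p x ⊗ y`. -/
def antiMap (L : ℕ) (r : Fin 2) : H L →ₗ[ℂ] H (L + 1) :=
  if r = 0 then mulVarMap L 1 else -mulVarMap L 0

theorem mulVarMap_substitution (k : Matrix (Fin 2) (Fin 2) ℂ) (p : MvPolynomial (Fin 2) ℂ)
    (r : Fin 2) : substitution k (p * X r) =
      substitution k p * (C (k 0 r) * X 0 + C (k 1 r) * X 1) := by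
  simp [substitution]

/-- The antisymmetric vector `y ⊗ x - x ⊗ y` is fixed because `det k = 1`; this is where the
determinant enters. -/
theorem antiMap_T (L : ℕ) (k : K) (s : Fin 2) (p : H L) :
    antiMap L s (T L k p) = ∑ r, (k : Matrix _ _ ℂ) s r • T (L + 1) k (antiMap L r p) := by
  have hdet : (k : Matrix (Fin 2) (Fin 2) ℂ) 0 0 * (k : Matrix (Fin 2) (Fin 2) ℂ) 1 1 -
      (k : Matrix (Fin 2) (Fin 2) ℂ) 0 1 * (k : Matrix (Fin 2) (Fin 2) ℂ) 1 0 = 1 := by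
    rw [← Matrix.det_fin_two]
    exact (Matrix.mem_specialUnitaryGroup_iff.1 k.2).2
  have hC := congrArg (C : ℂ → MvPolynomial (Fin 2) ℂ) hdet
  simp only [map_sub, map_mul, map_one] at hC
  have h0 : ((T (L + 1) k (mulVarMap L 0 p) : H (L + 1)) : MvPolynomial (Fin 2) ℂ) = _ :=
    mulVarMap_substitution k p 0
  have h1 : ((T (L + 1) k (mulVarMap L 1 p) : H (L + 1)) : MvPolynomial (Fin 2) ℂ) = _ :=
    mulVarMap_substitution k p 1
  have e : ∀ r (q : H L), ((mulVarMap L r q : H (L + 1)) : MvPolynomial (Fin 2) ℂ) =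
      (q : MvPolynomial (Fin 2) ℂ) * X r :=
    fun _ _ => rfl
  have eT : ((T L k p : H L) : MvPolynomial (Fin 2) ℂ) = substitution k p := rfl
  apply Subtype.ext
  fin_cases s
  · simp only [Fin.sum_univ_two, antiMap, Fin.zero_eta, if_true, Submodule.coe_add,
      Submodule.coe_smul, smul_eq_C_mul, h1, one_ne_zero, if_false, LinearMap.neg_apply, map_neg,
      Submodule.coe_neg, h0, e, eT]
    linear_combination -(substitution (k : Matrix (Fin 2) (Fin 2) ℂ) p * X 1) * hC
  · simp only [Fin.sum_univ_two, antiMap, Fin.mk_one, if_true, Submodule.coe_add,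
      Submodule.coe_smul, smul_eq_C_mul, h1, one_ne_zero, if_false, LinearMap.neg_apply, map_neg,
      Submodule.coe_neg, h0, e, eT]
    linear_combination (substitution (k : Matrix (Fin 2) (Fin 2) ℂ) p * X 0) * hC

theorem psi_one_zero : ((psi 1 0 : H 1) : MvPolynomial (Fin 2) ℂ) = X 0 := by
  simp [psi, expo, X]

theorem psi_one_one : ((psi 1 1 : H 1) : MvPolynomial (Fin 2) ℂ) = X 1 := by
  simp [psi, expo, X]

theorem T_psi_one (k : K) (r : Fin 2) :
    T 1 k (psi 1 r) = ∑ s, (k : Matrix (Fin 2) (Fin 2) ℂ) s r • psi 1 s := by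
  apply Subtype.ext
  have h : ((T 1 k (psi 1 r) : H 1) : MvPolynomial (Fin 2) ℂ) =
    substitution k (psi 1 r : MvPolynomial (Fin 2) ℂ) := rfl
  rw [h, Fin.sum_univ_two, Submodule.coe_add, Submodule.coe_smul, Submodule.coe_smul,
    psi_one_zero, psi_one_one, smul_eq_C_mul, smul_eq_C_mul]
  fin_cases r
  · simp [psi_one_zero, substitution]
  · simp [psi_one_one, substitution]

theorem sum_coordinates_smul_psi (L : ℕ) (p : H L) : ∑ i, coordinates L p i • psi L i = p :=
  coordinates_injective L (coordinates_sum L _)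

/-- Here `β p = ∑ S_r p ⊗ ψ_r`, with `ψ_0 = x` and `ψ_1 = y`. The matrix by which the `S_r`
transform is the one that arises when `k` acts on the `ψ_r`, so equivariance is an exchange of two
sums. -/
theorem TT_comp_beta_one_of {L M : ℕ} (S : Fin 2 → H M →ₗ[ℂ] H L)
    (hS : ∀ (r : Fin 2) (i : Fin (M + 1)) (j : Fin (L + 1)),
      (clebschGordan L 1 M j r i : ℂ) = coordinates L (S r (psi M i)) j)
    (hT : ∀ (k : K) (s : Fin 2) (p : H M),
      S s (T M k p) = ∑ r, (k : Matrix (Fin 2) (Fin 2) ℂ) s r • T L k (S r p)) (k : K) :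
    TT L 1 (k, k) ∘ₗ beta L 1 M = beta L 1 M ∘ₗ T M k := by
  have hb : beta L 1 M = ∑ r : Fin 2, (TensorProduct.mk ℂ (H L) (H 1)).flip (psi 1 r) ∘ₗ S r := by
    refine (weightBasis M).ext fun i => ?_
    rw [beta, Module.Basis.constr_basis, coupledVector, Finset.sum_comm, LinearMap.sum_apply,
      weightBasis_apply]
    refine Finset.sum_congr rfl fun r _ => ?_
    simp only [LinearMap.comp_apply, LinearMap.flip_apply, TensorProduct.mk_apply]
    conv_rhs => rw [← sum_coordinates_smul_psi L (S r (psi M i)), TensorProduct.sum_tmul]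
    exact Finset.sum_congr rfl fun j _ => by rw [hS, TensorProduct.smul_tmul']
  ext1 p
  simp only [hb, LinearMap.comp_apply, LinearMap.sum_apply, LinearMap.flip_apply,
    TensorProduct.mk_apply, map_sum, TT, TensorProduct.map_tmul, T_psi_one, hT,
    TensorProduct.tmul_sum, TensorProduct.tmul_smul]
  rw [Finset.sum_comm]
  simp only [TensorProduct.smul_tmul']

/-! ### Derivatives and multiplication by variables in the weight basis. -/

theorem choose_real_succ {L i : ℕ} (h : i ≤ L) :
    (((L + 1).choose (L + 1 - i) : ℕ) : ℝ) * ((L : ℝ) + 1 - i) =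
      (L + 1) * ((L.choose (L - i) : ℕ) : ℝ) := by
  rw [Nat.choose_symm (by omega), Nat.choose_symm h]
  have h2 := Nat.choose_mul_succ_eq L i
  rw [← Nat.cast_inj (R := ℝ)] at h2
  push_cast [Nat.cast_sub (show i ≤ L + 1 by omega)] at h2
  linarith

theorem choose_real_succ' {L i : ℕ} (h : i ≤ L) :
    (((L + 1).choose (L + 1 - (i + 1)) : ℕ) : ℝ) * ((i : ℝ) + 1) =
      (L + 1) * ((L.choose (L - i) : ℕ) : ℝ) := by
  rw [Nat.choose_symm (by omega), Nat.choose_symm h]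
  have h2 := Nat.add_one_mul_choose_eq L i
  rw [← Nat.cast_inj (R := ℝ)] at h2
  push_cast at h2
  linarith

theorem expo_add_single_zero {L i : ℕ} (h : i ≤ L) :
    expo L i + Finsupp.single 0 1 = expo (L + 1) i := by
  ext r
  fin_cases r
  · simp [expo]; omega
  · simp [expo]

theorem expo_add_single_one (L i : ℕ) :
    expo L i + Finsupp.single 1 1 = expo (L + 1) (i + 1) := by
  ext r
  fin_cases r <;> simp [expo]

theorem coordinates_partialMap_zero {L : ℕ} (p : H (L + 1)) (j : Fin (L + 1)) :
    coordinates L (partialMap L 0 p) j =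
      (√((L + 1) * ((L : ℝ) + 1 - j)) : ℝ) * coordinates (L + 1) p j.castSucc := by
  have hj : (j : ℕ) ≤ L := Nat.lt_succ_iff.1 j.2
  have hj' : (j : ℝ) ≤ L := by exact_mod_cast hj
  have hc : coeff (expo L j) (pderiv 0 (p : MvPolynomial (Fin 2) ℂ)) =
      coeff (expo (L + 1) j) (p : MvPolynomial (Fin 2) ℂ) * ((L : ℂ) + 1 - j) := by
    rw [coeff_pderiv, expo_add_single_zero hj]
    simp [expo, Nat.cast_sub hj]
    ring_nf
    simp
  have h1 : ((√((L.choose (L - (j : ℕ)) : ℕ) : ℝ) : ℝ) : ℂ) ≠ 0 := sqrt_choose_ne_zero L j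
  have h2 : ((√(((L + 1).choose (L + 1 - (j : ℕ)) : ℕ) : ℝ) : ℝ) : ℂ) ≠ 0 :=
    sqrt_choose_ne_zero (L + 1) j.castSucc
  have h3 : √((L + 1) * ((L : ℝ) + 1 - j)) * √((L.choose (L - (j : ℕ)) : ℕ) : ℝ) =
      ((L : ℝ) + 1 - j) * √(((L + 1).choose (L + 1 - (j : ℕ)) : ℕ) : ℝ) := by
    rw [← Real.sqrt_mul (mul_nonneg (by positivity) (by linarith))]
    nth_rewrite 2 [← Real.sqrt_sq (show (0 : ℝ) ≤ (L : ℝ) + 1 - j by linarith)]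
    rw [← Real.sqrt_mul (sq_nonneg _)]
    congr 1
    linear_combination -((L : ℝ) + 1 - j) * choose_real_succ hj
  have h3' := congrArg (fun r : ℝ => (r : ℂ)) h3
  simp only [Complex.ofReal_mul, Complex.ofReal_sub, Complex.ofReal_add, Complex.ofReal_natCast,
    Complex.ofReal_one] at h3'
  change coeff (expo L j) (pderiv 0 (p : MvPolynomial (Fin 2) ℂ)) / _ =
    _ * (coeff (expo (L + 1) j) (p : MvPolynomial (Fin 2) ℂ) / _)
  simp only [Fin.val_castSucc]
  rw [hc, mul_div_assoc', div_eq_div_iff h1 h2]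
  linear_combination -coeff (expo (L + 1) j) (p : MvPolynomial (Fin 2) ℂ) * h3'

theorem coordinates_partialMap_one {L : ℕ} (p : H (L + 1)) (j : Fin (L + 1)) :
    coordinates L (partialMap L 1 p) j =
      (√((L + 1) * ((j : ℝ) + 1)) : ℝ) * coordinates (L + 1) p j.succ := by
  have hj : (j : ℕ) ≤ L := Nat.lt_succ_iff.1 j.2
  have hc : coeff (expo L j) (pderiv 1 (p : MvPolynomial (Fin 2) ℂ)) =
      coeff (expo (L + 1) (j + 1)) (p : MvPolynomial (Fin 2) ℂ) * ((j : ℂ) + 1) := by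
    rw [coeff_pderiv, expo_add_single_one]
    simp [expo]
  have h1 : ((√((L.choose (L - (j : ℕ)) : ℕ) : ℝ) : ℝ) : ℂ) ≠ 0 := sqrt_choose_ne_zero L j
  have h2 : ((√(((L + 1).choose (L + 1 - ((j : ℕ) + 1)) : ℕ) : ℝ) : ℝ) : ℂ) ≠ 0 :=
    sqrt_choose_ne_zero (L + 1) j.succ
  have h3 : √((L + 1) * ((j : ℝ) + 1)) * √((L.choose (L - (j : ℕ)) : ℕ) : ℝ) =
      ((j : ℝ) + 1) * √(((L + 1).choose (L + 1 - ((j : ℕ) + 1)) : ℕ) : ℝ) := by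
    rw [← Real.sqrt_mul (by positivity)]
    nth_rewrite 2 [← Real.sqrt_sq (show (0 : ℝ) ≤ (j : ℝ) + 1 by positivity)]
    rw [← Real.sqrt_mul (sq_nonneg _)]
    congr 1
    linear_combination -((j : ℝ) + 1) * choose_real_succ' hj
  have h3' := congrArg (fun r : ℝ => (r : ℂ)) h3
  simp only [Complex.ofReal_mul, Complex.ofReal_add, Complex.ofReal_natCast,
    Complex.ofReal_one] at h3'
  change coeff (expo L j) (pderiv 1 (p : MvPolynomial (Fin 2) ℂ)) / _ =
    _ * (coeff (expo (L + 1) (j.succ : Fin (L + 1 + 1))) (p : MvPolynomial (Fin 2) ℂ) / _)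
  simp only [Fin.val_succ]
  rw [hc, mul_div_assoc', div_eq_div_iff h1 h2]
  linear_combination -coeff (expo (L + 1) (j + 1)) (p : MvPolynomial (Fin 2) ℂ) * h3'

theorem mulVarMap_zero_psi (L : ℕ) (i : Fin (L + 1)) :
    mulVarMap L 0 (psi L i) =
      ((√(((L : ℝ) + 1 - i) / (L + 1)) : ℝ) : ℂ) • psi (L + 1) i.castSucc := by
  have hi : (i : ℕ) ≤ L := Nat.lt_succ_iff.1 i.2
  have hi' : (i : ℝ) ≤ L := by exact_mod_cast hi
  apply Subtype.ext
  change monomial (expo L i) (_ : ℂ) * monomial (Finsupp.single 0 1) (1 : ℂ) =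
    (_ : ℂ) • monomial (expo (L + 1) i) (_ : ℂ)
  rw [monomial_mul, expo_add_single_zero hi, smul_monomial, mul_one, smul_eq_mul,
    ← Complex.ofReal_mul, ← Real.sqrt_mul (div_nonneg (by linarith) (by positivity))]
  congr 3
  simp only [Fin.val_castSucc]
  rw [div_mul_eq_mul_div, eq_div_iff (by positivity)]
  linear_combination -choose_real_succ hi

theorem mulVarMap_one_psi (L : ℕ) (i : Fin (L + 1)) :
    mulVarMap L 1 (psi L i) = ((√(((i : ℝ) + 1) / (L + 1)) : ℝ) : ℂ) • psi (L + 1) i.succ := by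
  have hi : (i : ℕ) ≤ L := Nat.lt_succ_iff.1 i.2
  apply Subtype.ext
  change monomial (expo L i) (_ : ℂ) * monomial (Finsupp.single 1 1) (1 : ℂ) =
    (_ : ℂ) • monomial (expo (L + 1) (i + 1)) (_ : ℂ)
  rw [monomial_mul, expo_add_single_one, smul_monomial, mul_one, smul_eq_mul,
    ← Complex.ofReal_mul, ← Real.sqrt_mul (by positivity)]
  congr 3
  simp only [Fin.val_succ]
  rw [div_mul_eq_mul_div, eq_div_iff (by positivity)]
  linear_combination -choose_real_succ' hi

theorem TT_comp_beta_one_up (L : ℕ) (k : K) :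
    TT L 1 (k, k) ∘ₗ beta L 1 (L + 1) = beta L 1 (L + 1) ∘ₗ T (L + 1) k := by
  have hL : (0 : ℝ) < L + 1 := by positivity
  have hsqrt : ∀ r : ℝ, √(r / (L + 1)) = ((L : ℝ) + 1)⁻¹ * √((L + 1) * r) := by
    intro r
    rw [← Real.sqrt_sq (inv_nonneg.2 hL.le), ← Real.sqrt_mul (sq_nonneg _)]
    congr 1
    field_simp
  -- The embedding into spin `ℓ` tensor `1/2` from above is polarisation `p ↦ ∑ ∂_r p ⊗ x_r`;
  -- division by the degree `L + 1` normalises it.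
  refine TT_comp_beta_one_of (fun r => ((((L : ℝ) + 1)⁻¹ : ℝ) : ℂ) • partialMap L r) ?_ ?_ k
  · intro r i j
    have hj : (j : ℕ) ≤ L := Nat.lt_succ_iff.1 j.2
    rw [LinearMap.smul_apply, map_smul, Pi.smul_apply, smul_eq_mul]
    fin_cases r
    · simp only [Fin.zero_eta, coordinates_partialMap_zero, coordinates_psi]
      rw [← mul_assoc, ← Complex.ofReal_mul, ← hsqrt]
      by_cases h : i = j.castSucc
      · rw [if_pos h, h, Fin.val_castSucc, clebschGordan_one_up_zero hj, mul_one]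
      · rw [if_neg h, mul_zero, clebschGordan_one_up_eq_zero (fun h' => h (Fin.ext h')),
          Complex.ofReal_zero]
    · simp only [Fin.mk_one, coordinates_partialMap_one, coordinates_psi]
      rw [← mul_assoc, ← Complex.ofReal_mul, ← hsqrt]
      by_cases h : i = j.succ
      · rw [if_pos h, h, Fin.val_succ, clebschGordan_one_up_one hj, mul_one]
      · rw [if_neg h, mul_zero, clebschGordan_one_up_eq_zero (fun h' => h (Fin.ext h')),
          Complex.ofReal_zero]
  · intro k s p
    simp only [LinearMap.smul_apply, partialMap_T, map_smul, Finset.smul_sum]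
    exact Finset.sum_congr rfl fun r _ => smul_comm _ _ _

theorem TT_comp_beta_one_down (M : ℕ) (k : K) :
    TT (M + 1) 1 (k, k) ∘ₗ beta (M + 1) 1 M = beta (M + 1) 1 M ∘ₗ T M k := by
  have hM : (0 : ℝ) < M + 1 := by positivity
  have hM2 : (0 : ℝ) < M + 2 := by positivity
  have hsqrt : ∀ r : ℝ, √(r / (M + 2)) = √(((M : ℝ) + 1) / (M + 2)) * √(r / (M + 1)) := by
    intro r
    rw [← Real.sqrt_mul (by positivity)]
    congr 1
    field_simp
  -- The constant is the ratio of the coefficients, with denominators `M + 2`, to those of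
  -- multiplication by a variable, with denominators `M + 1`, under the root.
  refine TT_comp_beta_one_of (fun r => ((√(((M : ℝ) + 1) / (M + 2)) : ℝ) : ℂ) • antiMap M r) ?_ ?_ k
  · intro r i j
    have hi : (i : ℕ) ≤ M := Nat.lt_succ_iff.1 i.2
    rw [LinearMap.smul_apply, map_smul, Pi.smul_apply, smul_eq_mul]
    fin_cases r
    · simp only [Fin.zero_eta, antiMap, if_true, mulVarMap_one_psi, map_smul, Pi.smul_apply,
        coordinates_psi, smul_eq_mul]
      rw [← mul_assoc, ← Complex.ofReal_mul, ← hsqrt]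
      by_cases h : i.succ = j
      · rw [if_pos h, ← h, Fin.val_succ, clebschGordan_one_down_zero hi, mul_one]
      · rw [if_neg h, mul_zero, clebschGordan_one_down_eq_zero
          (fun h' => h (Fin.ext (by simpa using h'))),
          Complex.ofReal_zero]
    · simp only [Fin.mk_one, antiMap, one_ne_zero, if_false, LinearMap.neg_apply,
        mulVarMap_zero_psi, map_neg, map_smul, Pi.neg_apply, Pi.smul_apply,
        coordinates_psi, smul_eq_mul, mul_neg]
      rw [← mul_assoc, ← Complex.ofReal_mul, ← hsqrt]
      by_cases h : i.castSucc = j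
      · rw [if_pos h, ← h, Fin.val_castSucc, clebschGordan_one_down_one hi, mul_one,
          Complex.ofReal_neg]
      · rw [if_neg h, mul_zero, clebschGordan_one_down_eq_zero
          (fun h' => h (Fin.ext (by simpa using h'))), Complex.ofReal_zero, neg_zero]
  · intro k s p
    simp only [LinearMap.smul_apply, antiMap_T, map_smul, Finset.smul_sum]
    exact Finset.sum_congr rfl fun r _ => smul_comm _ _ _

/-- `β^{ℓ,1/2}_m` is equivariant. -/
theorem TT_comp_beta_one {L M : ℕ} (hM : M ∈ neighbours L) (k : K) :
    TT L 1 (k, k) ∘ₗ beta L 1 M = beta L 1 M ∘ₗ T M k := by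
  rcases L with _ | L
  · rw [neighbours_zero, Finset.mem_singleton] at hM
    subst hM
    exact TT_comp_beta_one_up 0 k
  · rw [neighbours_succ, Finset.mem_insert, Finset.mem_singleton] at hM
    rcases hM with rfl | rfl
    · exact TT_comp_beta_one_down M k
    · exact TT_comp_beta_one_up (L + 1) k

end Equivariance

section Product

open scoped Kronecker

/-! ### Matrices of the representations and of the spherical functions -/

/-- The matrix of `T^ℓ(k)` with respect to the weight basis. -/
def repMatrix (L : ℕ) (k : K) : Matrix (Fin (L + 1)) (Fin (L + 1)) ℂ :=
  LinearMap.toMatrix (weightBasis L) (weightBasis L) (T L k)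

/-- The weight basis as an orthonormal basis. -/
def weightOrthonormalBasis (L : ℕ) : OrthonormalBasis (Fin (L + 1)) ℂ (H L) :=
  (weightBasis L).toOrthonormalBasis (by
    rw [show ⇑(weightBasis L) = psi L from funext (weightBasis_apply L)]
    exact orthonormal_psi L)

theorem toBasis_weightOrthonormalBasis (L : ℕ) :
    (weightOrthonormalBasis L).toBasis = weightBasis L :=
  Module.Basis.toBasis_toOrthonormalBasis _ _

theorem toMatrix_beta (L₁ L₂ L : ℕ) :
    LinearMap.toMatrix (weightBasis L) ((weightBasis L₁).tensorProduct (weightBasis L₂))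
      (beta L₁ L₂ L) = cgMatrix L₁ L₂ L := by
  ext ⟨p₁, p₂⟩ i
  rw [LinearMap.toMatrix_apply, beta, Module.Basis.constr_basis, coupledVector]
  simp only [← weightBasis_apply, map_sum, map_smul, Finsupp.finsetSum_apply, Finsupp.smul_apply,
    Module.Basis.tensorProduct_repr_tmul_apply, Module.Basis.repr_self, Finsupp.single_apply,
    smul_eq_mul, cgMatrix, Matrix.of_apply]
  simp

theorem toMatrix_TT (L₁ L₂ : ℕ) (x : U) :
    LinearMap.toMatrix ((weightBasis L₁).tensorProduct (weightBasis L₂))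
      ((weightBasis L₁).tensorProduct (weightBasis L₂)) (TT L₁ L₂ x) =
      repMatrix L₁ x.1 ⊗ₖ repMatrix L₂ x.2 :=
  TensorProduct.toMatrix_map _ _ _ _ _ _

theorem cgMatrix_conjTranspose (L₁ L₂ L : ℕ) :
    (cgMatrix L₁ L₂ L).conjTranspose = (cgMatrix L₁ L₂ L).transpose := by
  ext i p
  simp [cgMatrix, Matrix.conjTranspose_apply]

/-- Orthonormality of the weight bases makes the adjoint a conjugate transpose, and the coefficients
are real. -/
theorem toMatrix_sphericalFunction (L₁ L₂ L : ℕ) (x : U) :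
    LinearMap.toMatrix (weightBasis L) (weightBasis L) (sphericalFunction L₁ L₂ L x) =
      (cgMatrix L₁ L₂ L).transpose * (repMatrix L₁ x.1 ⊗ₖ repMatrix L₂ x.2) *
        cgMatrix L₁ L₂ L := by
  have h := LinearMap.toMatrix_adjoint (weightOrthonormalBasis L)
    ((weightOrthonormalBasis L₁).tensorProduct (weightOrthonormalBasis L₂)) (beta L₁ L₂ L)
  rw [OrthonormalBasis.toBasis_tensorProduct, toBasis_weightOrthonormalBasis,
    toBasis_weightOrthonormalBasis, toBasis_weightOrthonormalBasis, toMatrix_beta,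
    cgMatrix_conjTranspose] at h
  rw [sphericalFunction,
    LinearMap.toMatrix_comp _ ((weightBasis L₁).tensorProduct (weightBasis L₂)),
    LinearMap.toMatrix_comp _ ((weightBasis L₁).tensorProduct (weightBasis L₂)),
    h, toMatrix_beta, toMatrix_TT, Matrix.mul_assoc]

theorem zonalFunction_eq (L : ℕ) (x : U) :
    zonalFunction L x = ((cgMatrix L L 0).transpose * (repMatrix L x.1 ⊗ₖ repMatrix L x.2) *
      cgMatrix L L 0) 0 0 := by
  rw [zonalFunction, LinearMap.trace_eq_matrix_trace ℂ (weightBasis 0),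
    toMatrix_sphericalFunction]
  simp [Matrix.trace]

theorem repMatrix_kronecker_mul_cgMatrix {L M : ℕ} (hM : M ∈ neighbours L) (k : K) :
    (repMatrix L k ⊗ₖ repMatrix 1 k) * cgMatrix L 1 M = cgMatrix L 1 M * repMatrix M k := by
  have h := congrArg (LinearMap.toMatrix (weightBasis M)
    ((weightBasis L).tensorProduct (weightBasis 1))) (TT_comp_beta_one hM k)
  rwa [LinearMap.toMatrix_comp _ ((weightBasis L).tensorProduct (weightBasis 1)),
    LinearMap.toMatrix_comp _ (weightBasis M), toMatrix_beta, toMatrix_TT] at h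

/-- The decomposition of `T^ℓ ⊗ T^{1/2}`. -/
theorem repMatrix_kronecker_eq_sum (L : ℕ) (k : K) :
    repMatrix L k ⊗ₖ repMatrix 1 k =
      ∑ M ∈ neighbours L, cgMatrix L 1 M * repMatrix M k * (cgMatrix L 1 M).transpose := by
  conv_lhs => rw [← Matrix.mul_one (repMatrix L k ⊗ₖ repMatrix 1 k), ← sum_neighbours_cgMatrix,
    Finset.mul_sum]
  refine Finset.sum_congr rfl fun M hM => ?_
  rw [← Matrix.mul_assoc, repMatrix_kronecker_mul_cgMatrix hM]

/-! ### The product of spherical functions -/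

/-- The matrix of the map `H^ℓ → (H^{ℓ₁} ⊗ H^{1/2}) ⊗ (H^{ℓ₂} ⊗ H^{1/2})` that is built from
`β^{ℓ₁,ℓ₂}_ℓ` and the invariant vector of `H^{1/2} ⊗ H^{1/2}`. -/
def productMatrix (L₁ L₂ L : ℕ) :
    Matrix ((Fin (L₁ + 1) × Fin 2) × (Fin (L₂ + 1) × Fin 2)) (Fin (L + 1)) ℂ :=
  (cgMatrix L₁ L₂ L ⊗ₖ cgMatrix 1 1 0).submatrix (Equiv.prodProdProdComm _ _ _ _) fun i => (i, 0)

theorem productMatrix_apply (L₁ L₂ L : ℕ) (p : Fin (L₁ + 1) × Fin 2) (q : Fin (L₂ + 1) × Fin 2)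
    (i : Fin (L + 1)) : productMatrix L₁ L₂ L (p, q) i =
      cgMatrix L₁ L₂ L (p.1, q.1) i * cgMatrix 1 1 0 (p.2, q.2) 0 := rfl

/-- The scalar `φ(x)` is a 1 × 1 compression, and a Kronecker product of compressions is a
compression. The four tensor factors are then regrouped so that those on which the same component of
`x` acts stand together. -/
theorem zonalFunction_smul (L₁ L₂ L : ℕ) (x : U) :
    zonalFunction 1 x • ((cgMatrix L₁ L₂ L).transpose * (repMatrix L₁ x.1 ⊗ₖ repMatrix L₂ x.2) *
        cgMatrix L₁ L₂ L) =
      (productMatrix L₁ L₂ L).transpose *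
        ((repMatrix L₁ x.1 ⊗ₖ repMatrix 1 x.1) ⊗ₖ (repMatrix L₂ x.2 ⊗ₖ repMatrix 1 x.2)) *
        productMatrix L₁ L₂ L := by
  have h : (repMatrix L₁ x.1 ⊗ₖ repMatrix 1 x.1) ⊗ₖ (repMatrix L₂ x.2 ⊗ₖ repMatrix 1 x.2) =
      ((repMatrix L₁ x.1 ⊗ₖ repMatrix L₂ x.2) ⊗ₖ (repMatrix 1 x.1 ⊗ₖ repMatrix 1 x.2)).submatrix
        (Equiv.prodProdProdComm _ _ _ _) (Equiv.prodProdProdComm _ _ _ _) := by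
    ext p q
    simp only [Matrix.submatrix_apply, Matrix.kroneckerMap_apply, Equiv.prodProdProdComm_apply]
    ring
  rw [h, productMatrix, Matrix.transpose_submatrix, Matrix.submatrix_mul_equiv,
    Matrix.submatrix_mul_equiv, ← Matrix.kroneckerMap_transpose, ← Matrix.mul_kronecker_mul,
    ← Matrix.mul_kronecker_mul, zonalFunction_eq]
  ext i j
  simp only [Matrix.smul_apply, Matrix.submatrix_apply, Matrix.kroneckerMap_apply, smul_eq_mul]
  exact mul_comm _ _

/-- Leibniz rule: the operator acts on the two tensor factors in turn, and by `hY` it kills the spin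
0 vector. -/
theorem kroneckerSum_mul_productMatrix {L₁ L₂ L : ℕ} {X₁ : Matrix (Fin (L₁ + 1)) (Fin (L₁ + 1)) ℂ}
    {X₂ : Matrix (Fin (L₂ + 1)) (Fin (L₂ + 1)) ℂ} {X : Matrix (Fin (L + 1)) (Fin (L + 1)) ℂ}
    {Y : Matrix (Fin 2) (Fin 2) ℂ} (hX : kroneckerSum X₁ X₂ * cgMatrix L₁ L₂ L = cgMatrix L₁ L₂ L * X)
    (hY : kroneckerSum Y Y * cgMatrix 1 1 0 = 0) :
    kroneckerSum (kroneckerSum X₁ Y) (kroneckerSum X₂ Y) * productMatrix L₁ L₂ L =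
      productMatrix L₁ L₂ L * X := by
  ext ⟨⟨s₁, t₁⟩, ⟨s₂, t₂⟩⟩ i
  have h1 := congrFun (congrFun hX (s₁, s₂)) i
  have h2 := congrFun (congrFun hY (t₁, t₂)) 0
  rw [kroneckerSum_mul_apply, Matrix.mul_apply] at h1
  rw [kroneckerSum_mul_apply, Matrix.zero_apply] at h2
  rw [kroneckerSum_mul_apply, sum_kroneckerSum_mul _ _ (s₁, t₁)
    (fun q => productMatrix L₁ L₂ L (q, (s₂, t₂)) i), sum_kroneckerSum_mul _ _ (s₂, t₂)
    (fun q => productMatrix L₁ L₂ L ((s₁, t₁), q) i), Matrix.mul_apply]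
  simp only [productMatrix_apply] at h1 h2 ⊢
  simp only [← mul_assoc, mul_right_comm _ (cgMatrix 1 1 0 (t₁, t₂) 0)]
  simp only [mul_right_comm _ (cgMatrix L₁ L₂ L (s₁, s₂) i), ← Finset.sum_mul]
  linear_combination cgMatrix 1 1 0 (t₁, t₂) 0 * h1 + cgMatrix L₁ L₂ L (s₁, s₂) i * h2

theorem kroneckerSum_mul_kronecker {m n m' n' : Type*} [Fintype m] [Fintype n] [Fintype m']
    [Fintype n'] [DecidableEq m] [DecidableEq n] [DecidableEq m'] [DecidableEq n']
    {X : Matrix m m ℂ} {Y : Matrix n n ℂ} {X' : Matrix m' m' ℂ} {Y' : Matrix n' n' ℂ}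
    {P : Matrix m m' ℂ} {Q : Matrix n n' ℂ} (hP : X * P = P * X') (hQ : Y * Q = Q * Y') :
    kroneckerSum X Y * (P ⊗ₖ Q) = (P ⊗ₖ Q) * kroneckerSum X' Y' := by
  simp only [kroneckerSum, Matrix.add_mul, Matrix.mul_add, ← Matrix.mul_kronecker_mul, hP, hQ,
    Matrix.one_mul, Matrix.mul_one]

/-- The component of `productMatrix` in `H^{m₁,m₂}`. -/
def recursionMatrix (L₁ L₂ M₁ M₂ L : ℕ) :
    Matrix (Fin (M₁ + 1) × Fin (M₂ + 1)) (Fin (L + 1)) ℂ :=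
  ((cgMatrix L₁ 1 M₁).transpose ⊗ₖ (cgMatrix L₂ 1 M₂).transpose) * productMatrix L₁ L₂ L

/-- Raising, lowering and weight operators are treated at once. The family `Z` of transposes is
needed because moving `X` past `Cᵀ` is the transpose of moving `Z` past `C`; `h0` makes the spin 0
vector invariant. -/
theorem kroneckerSum_mul_recursionMatrix {L₁ L₂ M₁ M₂ L : ℕ}
    (X Z : ∀ n : ℕ, Matrix (Fin (n + 1)) (Fin (n + 1)) ℂ) (hXZ : ∀ n, (X n).transpose = Z n)
    (hX : ∀ L₁ L₂ L, kroneckerSum (X L₁) (X L₂) * cgMatrix L₁ L₂ L = cgMatrix L₁ L₂ L * X L)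
    (hZ : ∀ L₁ L₂ L, kroneckerSum (Z L₁) (Z L₂) * cgMatrix L₁ L₂ L = cgMatrix L₁ L₂ L * Z L)
    (h0 : X 0 = 0) :
    kroneckerSum (X M₁) (X M₂) * recursionMatrix L₁ L₂ M₁ M₂ L =
      recursionMatrix L₁ L₂ M₁ M₂ L * X L := by
  have hT : ∀ L M, X M * (cgMatrix L 1 M).transpose =
      (cgMatrix L 1 M).transpose * kroneckerSum (X L) (X 1) := by
    intro L M
    have := congrArg Matrix.transpose (hZ L 1 M)
    rw [Matrix.transpose_mul, Matrix.transpose_mul, kroneckerSum_transpose] at this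
    simp only [← hXZ, Matrix.transpose_transpose] at this
    exact this.symm
  rw [recursionMatrix, ← Matrix.mul_assoc, kroneckerSum_mul_kronecker (hT L₁ M₁) (hT L₂ M₂),
    Matrix.mul_assoc, kroneckerSum_mul_productMatrix (hX L₁ L₂ L), Matrix.mul_assoc]
  rw [hX, h0, Matrix.mul_zero]

theorem raiseMatrix_zero : raiseMatrix 0 = 0 := by
  ext i j
  simp [raiseMatrix]

theorem weightMatrix_zero : weightMatrix 0 = 0 := by
  ext i j
  fin_cases i; fin_cases j
  simp [weightMatrix, weight]

theorem isIntertwiner_recursionMatrix (L₁ L₂ M₁ M₂ L : ℕ) :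
    IsIntertwiner (recursionMatrix L₁ L₂ M₁ M₂ L) where
  raise := kroneckerSum_mul_recursionMatrix raiseMatrix lowerMatrix (fun _ => rfl)
    kroneckerSum_raiseMatrix_mul_cgMatrix kroneckerSum_lowerMatrix_mul_cgMatrix raiseMatrix_zero
  lower := kroneckerSum_mul_recursionMatrix lowerMatrix raiseMatrix (fun _ => rfl)
    kroneckerSum_lowerMatrix_mul_cgMatrix kroneckerSum_raiseMatrix_mul_cgMatrix
    (by rw [lowerMatrix, raiseMatrix_zero, Matrix.transpose_zero])
  wt := kroneckerSum_mul_recursionMatrix weightMatrix weightMatrix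
    (fun _ => Matrix.diagonal_transpose _)
    kroneckerSum_weightMatrix_mul_cgMatrix kroneckerSum_weightMatrix_mul_cgMatrix weightMatrix_zero

theorem recursionMatrix_apply (L₁ L₂ M₁ M₂ L : ℕ) (u : Fin (M₁ + 1) × Fin (M₂ + 1))
    (i : Fin (L + 1)) : recursionMatrix L₁ L₂ M₁ M₂ L u i =
      ∑ q : (Fin (L₁ + 1) × Fin 2) × (Fin (L₂ + 1) × Fin 2),
        cgMatrix L₁ 1 M₁ q.1 u.1 * cgMatrix L₂ 1 M₂ q.2 u.2 *
          (cgMatrix L₁ L₂ L (q.1.1, q.2.1) i * cgMatrix 1 1 0 (q.1.2, q.2.2) 0) := rfl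

theorem sum_recursionMatrix_mul (L₁ L₂ M₁ M₂ L : ℕ) :
    ∑ u, recursionMatrix L₁ L₂ M₁ M₂ L u (Fin.last L) * cgMatrix M₁ M₂ L u (Fin.last L) =
      (recursionCoeff L₁ L₂ M₁ M₂ L : ℂ) := by
  simp only [recursionMatrix_apply, Finset.sum_mul]
  rw [Finset.sum_comm, recursionCoeff, Fintype.sum_prod_type]
  simp only [Fintype.sum_prod_type]
  push_cast
  refine Finset.sum_congr rfl fun s₁ _ => ?_
  rw [Finset.sum_comm]
  refine Finset.sum_congr rfl fun s₂ _ => Finset.sum_congr rfl fun t₁ _ =>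
    Finset.sum_congr rfl fun t₂ _ => Finset.sum_congr rfl fun u₁ _ =>
    Finset.sum_congr rfl fun u₂ _ => ?_
  simp only [recursionTerm, cgMatrix, Matrix.of_apply, Fin.val_last, Fin.val_zero]
  push_cast
  ring

/-- Multiplicity one supplies the proportionality, and the pairing of highest-weight columns that
gives the factor is the sum defining `a`. -/
theorem recursionMatrix_eq (L₁ L₂ M₁ M₂ L : ℕ) :
    recursionMatrix L₁ L₂ M₁ M₂ L =
      (recursionCoeff L₁ L₂ M₁ M₂ L : ℂ) • cgMatrix M₁ M₂ L := by
  rw [← sum_recursionMatrix_mul]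
  exact (isIntertwiner_recursionMatrix L₁ L₂ M₁ M₂ L).eq_smul_cgMatrix

theorem sum_kronecker_sum {ι κ m n : Type*} (s : Finset ι) (t : Finset κ) (A : ι → Matrix m m ℂ)
    (B : κ → Matrix n n ℂ) :
    (∑ i ∈ s, A i) ⊗ₖ (∑ j ∈ t, B j) = ∑ i ∈ s, ∑ j ∈ t, A i ⊗ₖ B j := by
  ext p q
  simp only [Matrix.kroneckerMap_apply, Matrix.sum_apply, Finset.sum_mul_sum]

theorem zonalFunction_smul_sphericalFunction (L₁ L₂ L : ℕ) (x : U) :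
    zonalFunction 1 x • sphericalFunction L₁ L₂ L x =
      ∑ M₁ ∈ neighbours L₁, ∑ M₂ ∈ neighbours L₂,
        ((|recursionCoeff L₁ L₂ M₁ M₂ L| ^ 2 : ℝ) : ℂ) • sphericalFunction M₁ M₂ L x := by
  apply (LinearMap.toMatrix (weightBasis L) (weightBasis L)).injective
  simp only [map_smul, map_sum, toMatrix_sphericalFunction]
  rw [zonalFunction_smul, repMatrix_kronecker_eq_sum, repMatrix_kronecker_eq_sum,
    sum_kronecker_sum]
  simp only [Matrix.mul_sum, Matrix.sum_mul]
  refine Finset.sum_congr rfl fun M₁ _ => Finset.sum_congr rfl fun M₂ _ => ?_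
  -- The component to the right of `T^{m₁} ⊗ T^{m₂}` is `a C` and the one to the left is its
  -- transpose `a Cᵀ`; as `a` is real, the product of the scalars is `|a|²`.
  have h := recursionMatrix_eq L₁ L₂ M₁ M₂ L
  have hT := congrArg Matrix.transpose h
  rw [recursionMatrix] at h
  rw [recursionMatrix, Matrix.transpose_mul, ← Matrix.kroneckerMap_transpose,
    Matrix.transpose_transpose, Matrix.transpose_transpose] at hT
  rw [Matrix.mul_kronecker_mul, Matrix.mul_kronecker_mul, Matrix.mul_assoc, Matrix.mul_assoc,
    h, ← Matrix.mul_assoc, ← Matrix.mul_assoc, hT, Matrix.transpose_smul, sq_abs]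
  simp only [Matrix.smul_mul, Matrix.mul_smul, smul_smul]
  rw [Complex.ofReal_pow, sq]

theorem recursionCoeff_succ_ne_zero {L₁ L₂ L : ℕ} (hL : ContainsType L₁ L₂ L) :
    recursionCoeff L₁ L₂ (L₁ + 1) (L₂ + 1) L ≠ 0 := by
  obtain ⟨a, b, c, rfl, rfl, rfl⟩ := containsType_iff.1 hL
  intro h0
  -- At this entry the top weight `u₁` forces `s₁` to be top and `t₁ = 1`; the spin 0 coupling then
  -- gives `t₂ = 0`, hence `s₂ = c`. All four coefficients in the surviving summand are positive.
  have h := congrFun (congrFun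
    (recursionMatrix_eq (a + b) (a + c) (a + b + 1) (a + c + 1) (b + c))
    (Fin.last _, ⟨c, by omega⟩)) (Fin.last _)
  rw [h0, Complex.ofReal_zero, zero_smul, Matrix.zero_apply, recursionMatrix_apply,
    Finset.sum_eq_single ((Fin.last _, 1), (⟨c, by omega⟩, 0))] at h
  · simp only [cgMatrix, Matrix.of_apply, Fin.val_last, Fin.val_one, Fin.val_zero] at h
    rw [clebschGordan_one_up_one le_rfl, clebschGordan_one_up_zero (by omega)] at h
    have h1 : clebschGordan 1 1 0 1 0 0 = _ := clebschGordan_one_down_zero (le_refl 0)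
    have h2 := clebschGordan_highest_pos a b c
    have h3 : (0 : ℝ) < ((a + c : ℕ) : ℝ) + 1 - c := by
      push_cast
      linarith [Nat.cast_nonneg (α := ℝ) a]
    rw [h1] at h
    have : (0 : ℝ) < √((((a + b : ℕ) : ℝ) + 1) / (((a + b : ℕ) : ℝ) + 1)) *
        √((((a + c : ℕ) : ℝ) + 1 - c) / (((a + c : ℕ) : ℝ) + 1)) *
        (clebschGordan (a + b) (a + c) (b + c) (a + b) c (b + c) *
          √((((0 : ℕ) : ℝ) + 1) / (((0 : ℕ) : ℝ) + 2))) := by positivity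
    exact this.ne' (by exact_mod_cast h)
  · rintro ⟨⟨s₁, t₁⟩, ⟨s₂, t₂⟩⟩ _ hne
    by_contra hz
    simp only [cgMatrix, Matrix.of_apply, mul_ne_zero_iff, Complex.ofReal_ne_zero] at hz
    obtain ⟨⟨hz1, hz2⟩, -, hz4⟩ := hz
    have w1 := (clebschGordan_ne_zero hz1).2.2.2.2
    have w2 := (clebschGordan_ne_zero hz2).2.2.2.2
    have w4 := (clebschGordan_ne_zero hz4).2.2.2.2
    simp only [weight, Fin.val_last, Fin.val_zero] at w1 w2 w4
    push_cast at w1 w2 w4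
    refine hne ?_
    simp only [Prod.mk.injEq, Fin.ext_iff, Fin.val_last, Fin.val_one, Fin.val_zero]
    omega
  · simp

theorem weight_of_recursionTerm_ne_zero {L₁ L₂ M₁ M₂ L s₁ s₂ t₁ t₂ u₁ u₂ : ℕ}
    (h : recursionTerm L₁ L₂ M₁ M₂ L s₁ s₂ t₁ t₂ u₁ u₂ ≠ 0) :
    weight L₁ s₁ + weight L₂ s₂ = L ∧ weight 1 t₁ + weight 1 t₂ = 0 ∧
      weight M₁ u₁ = weight L₁ s₁ + weight 1 t₁ ∧ weight M₂ u₂ = weight L₂ s₂ + weight 1 t₂ := by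
  simp only [recursionTerm, mul_ne_zero_iff] at h
  obtain ⟨⟨⟨⟨h1, h2⟩, h3⟩, h4⟩, -⟩ := h
  refine ⟨?_, ?_, (clebschGordan_ne_zero h3).2.2.2.2.symm,
    (clebschGordan_ne_zero h4).2.2.2.2.symm⟩
  · rw [(clebschGordan_ne_zero h1).2.2.2.2, weight]
    ring
  · rw [(clebschGordan_ne_zero h2).2.2.2.2, weight]
    rfl

end Product

end

end SUTwo

theorem mainTheorem7 (L₁ L₂ L : ℕ) (hL : SUTwo.ContainsType L₁ L₂ L) :
    (∀ x : SUTwo.U,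
      SUTwo.zonalFunction 1 x • SUTwo.sphericalFunction L₁ L₂ L x =
        ∑ M₁ ∈ SUTwo.neighbours L₁, ∑ M₂ ∈ SUTwo.neighbours L₂,
          ((|SUTwo.recursionCoeff L₁ L₂ M₁ M₂ L| ^ 2 : ℝ) : ℂ) •
            SUTwo.sphericalFunction M₁ M₂ L x) ∧
    SUTwo.recursionCoeff L₁ L₂ (L₁ + 1) (L₂ + 1) L ≠ 0 ∧
    (∀ M₁ ∈ SUTwo.neighbours L₁, ∀ M₂ ∈ SUTwo.neighbours L₂,
      ∀ (s₁ : Fin (L₁ + 1)) (s₂ : Fin (L₂ + 1)) (t₁ t₂ : Fin 2)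
        (u₁ : Fin (M₁ + 1)) (u₂ : Fin (M₂ + 1)),
        SUTwo.recursionTerm L₁ L₂ M₁ M₂ L s₁ s₂ t₁ t₂ u₁ u₂ ≠ 0 →
          SUTwo.weight L₁ s₁ + SUTwo.weight L₂ s₂ = L ∧
          SUTwo.weight 1 t₁ + SUTwo.weight 1 t₂ = 0 ∧
          SUTwo.weight M₁ u₁ = SUTwo.weight L₁ s₁ + SUTwo.weight 1 t₁ ∧
          SUTwo.weight M₂ u₂ = SUTwo.weight L₂ s₂ + SUTwo.weight 1 t₂) := by
  exact ⟨SUTwo.zonalFunction_smul_sphericalFunction L₁ L₂ L, SUTwo.recursionCoeff_succ_ne_zero hL,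
    fun _ _ _ _ _ _ _ _ _ _ => SUTwo.weight_of_recursionTerm_ne_zero⟩
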